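/- Let $n\ge 2$, let $0<a_1\le\dots\le a_n$, $A=\mathrm{diag}(a_1,\dots,a_n)$, and let $\langle\cdot,\cdot\rangle$ be the standard Hermitian product on $\mathbb C^n$, conjugate-linear in the first argument, with $\langle v,w\rangle_A:=\langle Av,w\rangle$. Let $g_A$ be the restriction of $\mathrm{Re}\langle\cdot,\cdot\rangle_A$ and $\alpha_A$ the restriction of the one-form $(\alpha_A)_z=\tfrac12\mathrm{Im}\langle z,\cdot\rangle_A$ to the unit sphere $\mathbb S^{2n-1}\subset\mathbb C^n$. Let $V:\mathbb S^{2n-1}\to\mathbb R$ be a smooth function which, in the coordinates $z_j=\theta_je^{i\varphi_j}$ with $\sum_j\theta_j^2=1$, does not depend on $\varphi_1,\dots,\varphi_n$. Consider the electromagnetic Lagrangian on $T\mathbb S^{2n-1}$ $$L(q,v)=\tfrac12 (g_A)_q(v,v)-(\alpha_A)_q(v)-V(q),$$ its Euler–Lagrange flow (whose trajectories are the curves $(\gamma,\dot\gamma)$ with $\gamma$ a critical point of $\int L(\gamma,\dot\gamma)\,dt$ with fixed endpoints), and the Poisson bracket on $T\mathbb S^{2n-1}$ of the twisted symplectic form $\omega_{d\alpha_A}=d\lambda-\pi^*d\alpha_A$,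 where $\lambda_{(q,v)}(\cdot)=(g_A)_q(v,d\pi\,\cdot)$ and $\pi:T\mathbb S^{2n-1}\to\mathbb S^{2n-1}$ is the projection. Then the $n$ conjugate momenta $c_j=\partial L/\partial\dot\varphi_j$ (that is, the derivative of $L$ in the fibre direction of the vector field $\partial_{\varphi_j}=(0,\dots,iz_j,\dots,0)$), $j=1,\dots,n$, together with the energy $E_V(q,v)=\tfrac12(g_A)_q(v,v)+V(q)$ are $n+1$ smooth functions on $T\mathbb S^{2n-1}$ which are constant along the Euler–Lagrange flow of $L$, pairwise Poisson-commute, and are functionally independent (their differentials are linearly independent at all points of an open dense subset of $T\mathbb S^{2n-1}$). If $n=2$, the system is completely integrable: there are $\dim\mathbb S^{2n-1}=3$ independent pairwise Poisson-commuting integrals of motion. The same conclusions hold with $V=0$ for the exact magnetic system $(E(A),g,d\alpha)$ on the ellipsoid $E(A)=\{z\in\mathbb C^n:\langle A^{-1}z,z\rangle=1\}$, where $g$ is the restriction of the Euclidean metric $\mathrm{Re}\langle\cdot,\cdot\rangle$ and $\alpha_z=\tfrac12\mathrm{Im}\langle z,\cdot\rangle$: the $n$ conjugate momenta of $L(q,v)=\tfrac12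 g_q(v,v)-\alpha_q(v)$ and the kinetic energy are independent, pairwise commuting (for $\omega_{d\alpha}$) integrals of motion, and for $n=2$ the system is completely integrable. -/

import Mathlib

open scoped ContDiff

noncomputable section

/-! ### Embedded submanifolds, their tangent bundles, smooth functions -/

section Embedded

variable {E : Type*} [NormedAddCommGroup E] [NormedSpace ℝ E]

/-- `c` is a smooth curve in `S` passing through `x` at time `0`. -/
def IsCurveThrough (S : Set E) (x : E) (c : ℝ → E) : Prop :=
  ContDiff ℝ ∞ c ∧ (∀ t, c t ∈ S) ∧ c 0 = x

/-- The tangent space `T_x S` of an embedded submanifold `S` of a vector space: the velocities of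
smooth curves in `S` through `x`. -/
def tangentVectors (S : Set E) (x : E) : Set E :=
  {v | ∃ c : ℝ → E, IsCurveThrough S x c ∧ deriv c 0 = v}

/-- The tangent bundle `TS`, as the embedded submanifold of all `(q, v)` with `q ∈ S`,
`v ∈ T_q S`. -/
def tangentBundleOf (S : Set E) : Set (E × E) :=
  {p | p.1 ∈ S ∧ p.2 ∈ tangentVectors S p.1}

/-- A function is smooth on a (closed) embedded submanifold `S` if its restriction to `S` extends
to a smooth function on the ambient space. Values off `S` are irrelevant. -/
def IsSmoothOnSubmanifold (S : Set E) (F : E → ℝ) : Prop :=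
  ∃ G : E → ℝ, ContDiff ℝ ∞ G ∧ Set.EqOn F G S

/-- The differentials of `F 0, …, F (k-1)`, as linear functionals on `T_x S`, are linearly
independent: no nontrivial linear combination of the functions has vanishing derivative along all
smooth curves in `S` through `x`. -/
def IndependentAt (S : Set E) {k : ℕ} (F : Fin k → E → ℝ) (x : E) : Prop :=
  ∀ β : Fin k → ℝ,
    (∀ c : ℝ → E, IsCurveThrough S x c → deriv (fun t => ∑ i, β i * F i (c t)) 0 = 0) → β = 0

/-- Functional independence of `F 0, …, F (k-1)` on `S`: their differentials are linearly
independent at all points of an open dense subset of `S`. -/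
def FunctionallyIndependent (S : Set E) {k : ℕ} (F : Fin k → E → ℝ) : Prop :=
  ∃ U : Set E, IsOpen U ∧ S ⊆ closure (S ∩ U) ∧ ∀ x ∈ S ∩ U, IndependentAt S F x

/-! ### Euler–Lagrange curves -/

/-- The action `∫_a^b L(c(t), ċ(t)) dt`. -/
def action (L : E × E → ℝ) (c : ℝ → E) (a b : ℝ) : ℝ :=
  ∫ t in a..b, L (c t, deriv c t)

/-- `γ`, defined on the open interval `J`, is an Euler–Lagrange curve of the Lagrangian
`L : TS → ℝ`: it is a smooth curve in `S`, and for every `[a, b] ⊆ J` it is a critical point of the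
action on `[a, b]` among smooth curves in `S` with the same endpoints. -/
def IsEulerLagrangeCurve (S : Set E) (L : E × E → ℝ) (J : Set ℝ) (γ : ℝ → E) : Prop :=
  ContDiffOn ℝ ∞ γ J ∧ (∀ t ∈ J, γ t ∈ S) ∧
    ∀ a b : ℝ, a < b → Set.Icc a b ⊆ J →
      ∀ (ε : ℝ) (Γ : ℝ → ℝ → E), 0 < ε →
        ContDiffOn ℝ ∞ (fun p : ℝ × ℝ => Γ p.1 p.2) (Set.Ioo (-ε) ε ×ˢ J) →
        (∀ s ∈ Set.Ioo (-ε) ε, ∀ t ∈ J, Γ s t ∈ S) →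
        (∀ t ∈ J, Γ 0 t = γ t) →
        (∀ s ∈ Set.Ioo (-ε) ε, Γ s a = γ a ∧ Γ s b = γ b) →
        HasDerivAt (fun s => action L (Γ s) a b) 0 0

/-- `F : TS → ℝ` is an integral of motion of the Euler–Lagrange flow of `L`: it is constant along
`t ↦ (γ(t), γ̇(t))` for every Euler–Lagrange curve `γ` on an open interval. -/
def IsIntegralOfMotion (S : Set E) (L F : E × E → ℝ) : Prop :=
  ∀ (J : Set ℝ) (γ : ℝ → E), IsOpen J → J.OrdConnected → IsEulerLagrangeCurve S L J γ →
    ∀ s ∈ J, ∀ t ∈ J, F (γ s, deriv γ s) = F (γ t, deriv γ t)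

end Embedded

/-! ### Exact magnetic systems on embedded submanifolds -/

/-- An exact magnetic system `(M, g, dα)` on an embedded submanifold `M` of a vector space `E`,
where the metric `g` and the magnetic potential `α` are restrictions to `M` of a Riemannian metric
and of a one-form on `E`. -/
structure MagneticSystem (E : Type*) [NormedAddCommGroup E] [NormedSpace ℝ E] where
  /-- the submanifold -/
  M : Set E
  /-- the metric -/
  g : E → E →L[ℝ] E →L[ℝ] ℝ
  /-- the magnetic potential -/
  α : E → E →L[ℝ] ℝ
  g_smooth : ContDiff ℝ ∞ g
  g_symm : ∀ q v w, g q v w = g q w v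
  g_pos : ∀ q v, v ≠ 0 → 0 < g q v v
  α_smooth : ContDiff ℝ ∞ α

namespace MagneticSystem

variable {E : Type*} [NormedAddCommGroup E] [NormedSpace ℝ E] (S : MagneticSystem E)

/-- The phase space `TM ⊆ E × E`. -/
def TM : Set (E × E) := tangentBundleOf S.M

/-- The electromagnetic Lagrangian `L(q, v) = ½ g_q(v, v) - α_q(v) - V(q)`. -/
def lagrangian (V : E → ℝ) (x : E × E) : ℝ :=
  (1 / 2) * S.g x.1 x.2 x.2 - S.α x.1 x.2 - V x.1

/-- The energy `E_V(q, v) = ½ g_q(v, v) + V(q)`. -/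
def energy (V : E → ℝ) (x : E × E) : ℝ :=
  (1 / 2) * S.g x.1 x.2 x.2 + V x.1

/-- The metric Liouville one-form `λ_{(q,v)}(ξ, η) = g_q(v, ξ)`. -/
def liouvilleForm (x : E × E) : (E × E) [⋀^Fin 1]→L[ℝ] ℝ :=
  ContinuousAlternatingMap.ofSubsingleton ℝ (E × E) ℝ (0 : Fin 1)
    ((S.g x.1 x.2).comp (ContinuousLinearMap.fst ℝ E E))

/-- The magnetic potential `α` as a differential form of degree one. -/
def potentialForm (q : E) : E [⋀^Fin 1]→L[ℝ] ℝ :=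
  ContinuousAlternatingMap.ofSubsingleton ℝ E ℝ (0 : Fin 1) (S.α q)

/-- The twisted symplectic form `ω_{dα} = dλ - π^* dα`, where `π (q, v) = q`. Exterior derivatives
commute with restriction, so they are taken in the ambient space; `ω_{dα}` is only ever evaluated on
vectors tangent to `TM`. -/
def twistedForm (x : E × E) : (E × E) [⋀^Fin 2]→L[ℝ] ℝ :=
  extDeriv S.liouvilleForm x -
    (extDeriv S.potentialForm x.1).compContinuousLinearMap (ContinuousLinearMap.fst ℝ E E)

/-- `X ∈ T_x TM` is the value at `x` of the Hamiltonian vector field of `F : TM → ℝ`, i.e.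
`ω_{dα}(X, ·) = -dF` on `T_x TM`. -/
def IsHamiltonianVector (F : E × E → ℝ) (x X : E × E) : Prop :=
  X ∈ tangentVectors S.TM x ∧
    ∀ c : ℝ → E × E, IsCurveThrough S.TM x c →
      HasDerivAt (fun t => F (c t)) (-S.twistedForm x ![X, deriv c 0]) 0

/-- `{F, G} = ω_{dα}(X_F, X_G) = 0` on all of `TM`, where `X_F`, `X_G` are the Hamiltonian vector
fields. -/
def PoissonCommute (F G : E × E → ℝ) : Prop :=
  ∀ x ∈ S.TM, ∃ X Y : E × E, S.IsHamiltonianVector F x X ∧ S.IsHamiltonianVector G x Y ∧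
    S.twistedForm x ![X, Y] = 0

/-- `F 0, …, F (k-1)` are `k` (functionally) independent, pairwise Poisson-commuting smooth
integrals of motion of the Euler–Lagrange flow of the electromagnetic Lagrangian with
potential `V`. -/
def AreIndependentCommutingIntegrals (V : E → ℝ) {k : ℕ} (F : Fin k → E × E → ℝ) : Prop :=
  (∀ i, IsSmoothOnSubmanifold S.TM (F i)) ∧
  (∀ i, IsIntegralOfMotion S.M (S.lagrangian V) (F i)) ∧
  (∀ i j, S.PoissonCommute (F i) (F j)) ∧
  FunctionallyIndependent S.TM F

/-- Complete (Liouville) integrability: there are as many independent Poisson-commuting integrals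
of motion as degrees of freedom, i.e. `N = dim M = ½ dim TM`. -/
def IsCompletelyIntegrable (V : E → ℝ) : Prop :=
  ∃ (N : ℕ) (F : Fin N → E × E → ℝ),
    (∀ q ∈ S.M, Module.finrank ℝ (Submodule.span ℝ (tangentVectors S.M q)) = N) ∧
    S.AreIndependentCommutingIntegrals V F

end MagneticSystem

/-! ### Complex ellipsoids and weighted spheres -/

section Ellipsoid

variable {n : ℕ}

/-- `ℂⁿ` with its standard Hermitian structure, conjugate-linear in the first argument. -/
abbrev CSpace (n : ℕ) := EuclideanSpace ℂ (Fin n)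

/-- The weighted Hermitian product `⟨v, w⟩_A = ⟨A v, w⟩`, `A = diag(a)`. -/
def weightedInner (a : Fin n → ℝ) (v w : CSpace n) : ℂ :=
  inner ℂ (WithLp.toLp 2 (fun j => (a j : ℂ) * v j) : CSpace n) w

theorem weightedInner_eq (a : Fin n → ℝ) (v w : CSpace n) :
    weightedInner a v w = ∑ j, (a j : ℂ) * ((starRingEnd ℂ) (v j) * w j) := by
  simp only [weightedInner, PiLp.inner_apply, RCLike.inner_apply, map_mul, Complex.conj_ofReal]
  exact Finset.sum_congr rfl fun j _ => by ring

theorem weightedInner_add_left (a : Fin n → ℝ) (u v w : CSpace n) :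
    weightedInner a (u + v) w = weightedInner a u w + weightedInner a v w := by
  simp only [weightedInner_eq, ← Finset.sum_add_distrib, PiLp.add_apply, map_add]
  exact Finset.sum_congr rfl fun j _ => by ring

theorem weightedInner_add_right (a : Fin n → ℝ) (u v w : CSpace n) :
    weightedInner a u (v + w) = weightedInner a u v + weightedInner a u w := by
  simp only [weightedInner_eq, ← Finset.sum_add_distrib, PiLp.add_apply]
  exact Finset.sum_congr rfl fun j _ => by ring

theorem weightedInner_smul_left (a : Fin n → ℝ) (r : ℝ) (v w : CSpace n) :
    weightedInner a (r • v) w = (r : ℂ) * weightedInner a v w := by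
  simp only [weightedInner_eq, Finset.mul_sum, PiLp.smul_apply, Complex.real_smul, map_mul,
    Complex.conj_ofReal]
  exact Finset.sum_congr rfl fun j _ => by ring

theorem weightedInner_smul_right (a : Fin n → ℝ) (r : ℝ) (v w : CSpace n) :
    weightedInner a v (r • w) = (r : ℂ) * weightedInner a v w := by
  simp only [weightedInner_eq, Finset.mul_sum, PiLp.smul_apply, Complex.real_smul]
  exact Finset.sum_congr rfl fun j _ => by ring

/-- The real bilinear form `Re ⟨v, w⟩_A`. -/
def weightedMetric (a : Fin n → ℝ) : CSpace n →L[ℝ] CSpace n →L[ℝ] ℝ :=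
  (LinearMap.mk₂ ℝ (fun v w : CSpace n => (weightedInner a v w).re)
    (fun u v w => by simp [weightedInner_add_left])
    (fun r v w => by simp [weightedInner_smul_left])
    (fun u v w => by simp [weightedInner_add_right])
    (fun r v w => by simp [weightedInner_smul_right])).toContinuousBilinearMap

/-- The one-form `½ Im ⟨z, ·⟩_A`, as a function (linear in `z`) of the base point `z`. -/
def weightedPotential (a : Fin n → ℝ) : CSpace n →L[ℝ] CSpace n →L[ℝ] ℝ :=
  (LinearMap.mk₂ ℝ (fun z w : CSpace n => (1 / 2) * (weightedInner a z w).im)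
    (fun u v w => by simp [weightedInner_add_left]; ring)
    (fun r v w => by simp [weightedInner_smul_left]; ring)
    (fun u v w => by simp [weightedInner_add_right]; ring)
    (fun r v w => by simp [weightedInner_smul_right]; ring)).toContinuousBilinearMap

theorem weightedMetric_apply (a : Fin n → ℝ) (v w : CSpace n) :
    weightedMetric a v w = (weightedInner a v w).re := rfl

theorem weightedMetric_symm (a : Fin n → ℝ) (v w : CSpace n) :
    weightedMetric a v w = weightedMetric a w v := by
  simp only [weightedMetric_apply, weightedInner_eq, Complex.re_sum]
  refine Finset.sum_congr rfl fun j _ => ?_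
  rw [Complex.re_ofReal_mul, Complex.re_ofReal_mul, Complex.mul_re, Complex.mul_re]
  simp only [Complex.conj_re, Complex.conj_im]
  ring

theorem weightedMetric_pos (a : Fin n → ℝ) (ha : ∀ j, 0 < a j) (v : CSpace n) (hv : v ≠ 0) :
    0 < weightedMetric a v v := by
  have key : weightedMetric a v v = ∑ j, a j * Complex.normSq (v j) := by
    simp only [weightedMetric_apply, weightedInner_eq, Complex.re_sum]
    refine Finset.sum_congr rfl fun j _ => ?_
    rw [← Complex.normSq_eq_conj_mul_self, Complex.re_ofReal_mul, Complex.ofReal_re]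
  rw [key]
  obtain ⟨j, hj⟩ : ∃ j, v j ≠ 0 := by
    by_contra h
    push Not at h
    exact hv (by ext j; simp [h j])
  exact Finset.sum_pos' (fun i _ => mul_nonneg (ha i).le (Complex.normSq_nonneg _))
    ⟨j, Finset.mem_univ _, mul_pos (ha j) (Complex.normSq_pos.mpr hj)⟩

/-- The exact magnetic system on `M ⊆ ℂⁿ` with metric `Re ⟨·, ·⟩_A` and magnetic potential
`½ Im ⟨z, ·⟩_A`. -/
def weightedSystem (M : Set (CSpace n)) (a : Fin n → ℝ) (ha : ∀ j, 0 < a j) :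
    MagneticSystem (CSpace n) where
  M := M
  g := fun _ => weightedMetric a
  α := fun z => weightedPotential a z
  g_smooth := contDiff_const
  g_symm := fun _ v w => weightedMetric_symm a v w
  g_pos := fun _ v hv => weightedMetric_pos a ha v hv
  α_smooth := (weightedPotential a).contDiff

/-- The exact magnetic system `(S^{2n-1}, g_A, dα_A)` on the standard unit sphere. -/
def sphereSystem (a : Fin n → ℝ) (ha : ∀ j, 0 < a j) : MagneticSystem (CSpace n) :=
  weightedSystem (Metric.sphere (0 : CSpace n) 1) a ha

/-- The complex ellipsoid `E(A) = {z | ⟨A⁻¹ z, z⟩ = 1}`. -/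
def ellipsoid (a : Fin n → ℝ) : Set (CSpace n) :=
  {z | weightedInner (fun j => (a j)⁻¹) z z = 1}

/-- The exact magnetic system `(E(A), g, dα)`: `g` is the restriction of the Euclidean metric and
`α_z = ½ Im ⟨z, ·⟩` for the standard Hermitian product. -/
def ellipsoidSystem (a : Fin n → ℝ) : MagneticSystem (CSpace n) :=
  weightedSystem (ellipsoid a) (fun _ => 1) (fun _ => one_pos)

/-- The polar coordinates `z_j = θ_j e^{i φ_j}`. -/
def polarPoint (θ φ : Fin n → ℝ) : CSpace n :=
  WithLp.toLp 2 (fun j => (θ j : ℂ) * Complex.exp (Complex.I * (φ j : ℂ)))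

/-- The coordinate vector field `∂_{φ_j}`, which at `z` is the vector `(0, …, i z_j, …, 0)`. -/
def angularField (j : Fin n) (z : CSpace n) : CSpace n :=
  EuclideanSpace.single j (Complex.I * z j)

/-- The conjugate momentum `c_j = ∂L / ∂φ̇_j` of the angle `φ_j`: the derivative of `L` in the
fibre direction `∂_{φ_j}`. -/
def conjugateMomentum (L : CSpace n × CSpace n → ℝ) (j : Fin n) (x : CSpace n × CSpace n) : ℝ :=
  deriv (fun s : ℝ => L (x.1, x.2 + s • angularField j x.1)) 0

/-- The potential `V` on the unit sphere does not depend on the angles `φ_1, …, φ_n`. -/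
def IndependentOfAngles (V : CSpace n → ℝ) : Prop :=
  ∀ θ φ φ' : Fin n → ℝ, ∑ j, θ j ^ 2 = 1 → V (polarPoint θ φ) = V (polarPoint θ φ')

/-- The `n` conjugate momenta `c_1, …, c_n` followed by the energy `E_V`. -/
def momentaAndEnergy (S : MagneticSystem (CSpace n)) (V : CSpace n → ℝ) :
    Fin (n + 1) → CSpace n × CSpace n → ℝ :=
  Fin.snoc (α := fun _ => CSpace n × CSpace n → ℝ)
    (fun j => conjugateMomentum (S.lagrangian V) j) (S.energy V)

end Ellipsoid

end

/-! The sphere and the ellipsoid are both unit quadrics `B z z = 1` of a weighted metric `B`, with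
weights `b = 1` and `b = 1/a`. The magnetic system on the quadric has its own weights: `a` for the
sphere, `1` for the ellipsoid. So both cases are one statement about two independent weight vectors
`a` and `b`.

The rotations of the single coordinates preserve every weighted metric, every weighted potential and
the function `V`. Their generators `angularMap j` are linear, commute, and are skew for all weighted
forms. Noether's theorem (`IsEulerLagrangeCurve.noether`) turns rotation invariance into
conservation of the momenta, and time translation into conservation of energy. It rests on the first
variation formula and a du Bois-Reymond argument.

For the brackets, the Hamiltonian vector of a momentum is the linear lift of its rotation to the
tangent bundle, so commutation reduces to skewness and commutativity of the generators. The
Hamiltonian vector of the energy exists by duality plus a Lagrange multiplier normal to the quadric;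
its bracket with a momentum is the derivative of the energy along a rotation, which is zero.

For independence, vertical tangent vectors `(0, η)` suffice. Along them a combination of the
differentials is the metric pairing of `η` with the same combination of the angular fields and the
velocity. That vector is itself tangent, so it must vanish. This forces all coefficients to be zero
once every coordinate of the point is nonzero and the velocity has a radial component in some
coordinate. Such points are dense when `n ≥ 2`. For `n = 2` the `n + 1` integrals are as many as the
dimension `2n - 1`. -/

/-! ### Unit quadrics of positive definite bilinear forms -/

section Quadric

variable {E : Type*} [NormedAddCommGroup E] [NormedSpace ℝ E] {B : E →L[ℝ] E →L[ℝ] ℝ}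

/-- The unit sphere `{z | B z z = 1}` of a bilinear form. -/
def unitQuadric (B : E →L[ℝ] E →L[ℝ] ℝ) : Set E := {z | B z z = 1}

/-- The radial projection `z / √(B z z)` onto the unit quadric. -/
noncomputable def radialProjection (B : E →L[ℝ] E →L[ℝ] ℝ) (z : E) : E := (√(B z z))⁻¹ • z

theorem radialProjection_mem {z : E} (hz : 0 < B z z) :
    radialProjection B z ∈ unitQuadric B := by
  have h : √(B z z) ≠ 0 := (Real.sqrt_pos.2 hz).ne'
  have h2 := Real.mul_self_sqrt hz.le
  simp only [radialProjection, unitQuadric, Set.mem_ofPred_eq, map_smul,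
    smul_apply, smul_eq_mul]
  field_simp
  rw [pow_two, h2]

theorem radialProjection_of_mem {z : E} (hz : z ∈ unitQuadric B) : radialProjection B z = z := by
  have h : B z z = 1 := hz
  simp [radialProjection, h]

theorem contDiffAt_radialProjection {z : E} (hz : 0 < B z z) :
    ContDiffAt ℝ ∞ (radialProjection B) z := by
  have h1 : ContDiff ℝ ∞ fun z : E => B z z := B.contDiff.clm_apply contDiff_id
  exact ((h1.contDiffAt.sqrt hz.ne').inv (Real.sqrt_pos.2 hz).ne').smul contDiffAt_id

theorem hasDerivAt_bilinear {c d : ℝ → E} {c' d' : E} {t : ℝ} (hc : HasDerivAt c c' t)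
    (hd : HasDerivAt d d' t) :
    HasDerivAt (fun s => B (c s) (d s)) (B c' (d t) + B (c t) d') t :=
  (B.hasFDerivAt.comp_hasDerivAt t hc).clm_apply hd

/-- The normalising factor varies at the rate `-B (c t) v`, which is zero in a tangent direction.
Hence the projection turns affine variations into variations inside the quadric without changing
their velocity. -/
theorem hasDerivAt_radialProjection (hs : ∀ v w, B v w = B w v) {c : ℝ → E} {v : E} {t : ℝ}
    (hc : HasDerivAt c v t) (hq : c t ∈ unitQuadric B) (hv : B (c t) v = 0) :
    HasDerivAt (fun s => radialProjection B (c s)) v t := by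
  have hq' : B (c t) (c t) = 1 := hq
  have h1 := hasDerivAt_bilinear (B := B) hc hc
  have h2 := ((h1.sqrt (by simp [hq'])).fun_inv (by simp [hq'])).fun_smul hc
  refine h2.congr_deriv ?_
  simp [hq', hv, hs v]

/-- For tangent `v` the mixed terms drop out and the value is `1 + t² B v v`. The projection is
therefore smooth along the entire line, which yields curves defined for all times. -/
theorem bilinear_add_smul_pos (hs : ∀ v w, B v w = B w v) (hp : ∀ v, v ≠ 0 → 0 < B v v)
    {q v : E} (hq : q ∈ unitQuadric B) (hv : B q v = 0) (t : ℝ) :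
    0 < B (q + t • v) (q + t • v) := by
  have hq' : B q q = 1 := hq
  have hvv : 0 ≤ B v v := by
    rcases eq_or_ne v 0 with rfl | h
    · simp
    · exact (hp v h).le
  simp only [map_add, map_smul, add_apply, smul_apply,
    smul_eq_mul, hv, hs v q, hq']
  nlinarith [mul_nonneg (sq_nonneg t) hvv]

theorem hasDerivAt_add_smul (q v : E) (t : ℝ) : HasDerivAt (fun s : ℝ => q + s • v) v t := by
  simpa using ((hasDerivAt_id t).smul_const v).const_add q

theorem contDiff_add_smul (q v : E) : ContDiff ℝ ∞ fun s : ℝ => q + s • v :=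
  contDiff_const.add (contDiff_id.smul contDiff_const)

theorem mem_tangentVectors_unitQuadric (hs : ∀ v w, B v w = B w v)
    (hp : ∀ v, v ≠ 0 → 0 < B v v) {q v : E} (hq : q ∈ unitQuadric B) :
    v ∈ tangentVectors (unitQuadric B) q ↔ B q v = 0 := by
  constructor
  · rintro ⟨c, ⟨hc, hcS, rfl⟩, rfl⟩
    have h := (hc.differentiable (by simp) 0).hasDerivAt
    have h1 := (hasDerivAt_bilinear (B := B) h h).unique
      ((hasDerivAt_const (0 : ℝ) (1 : ℝ)).congr_of_eventuallyEq (.of_forall hcS))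
    rw [hs] at h1
    linarith
  · intro hv
    refine ⟨fun t => radialProjection B (q + t • v), ⟨?_, fun t => ?_, ?_⟩, ?_⟩
    · exact contDiff_iff_contDiffAt.2 fun t =>
        ContDiffAt.comp (g := radialProjection B) t
          (contDiffAt_radialProjection (bilinear_add_smul_pos hs hp hq hv t))
          (contDiff_add_smul q v).contDiffAt
    · exact radialProjection_mem (bilinear_add_smul_pos hs hp hq hv t)
    · simpa using radialProjection_of_mem hq
    · exact (hasDerivAt_radialProjection hs (hasDerivAt_add_smul q v 0) (by simpa using hq)
        (by simpa using hv)).deriv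

theorem mem_tangentBundleOf_unitQuadric (hs : ∀ v w, B v w = B w v)
    (hp : ∀ v, v ≠ 0 → 0 < B v v) {x : E × E} :
    x ∈ tangentBundleOf (unitQuadric B) ↔ B x.1 x.1 = 1 ∧ B x.1 x.2 = 0 :=
  and_congr_right fun hq => mem_tangentVectors_unitQuadric hs hp hq

theorem mem_tangentVectors_tangentBundleOf_unitQuadric (hs : ∀ v w, B v w = B w v)
    (hp : ∀ v, v ≠ 0 → 0 < B v v) {x w : E × E} (hx : x ∈ tangentBundleOf (unitQuadric B)) :
    w ∈ tangentVectors (tangentBundleOf (unitQuadric B)) x ↔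
      B x.1 w.1 = 0 ∧ B w.1 x.2 + B x.1 w.2 = 0 := by
  constructor
  · rintro ⟨c, ⟨hc, hcS, rfl⟩, rfl⟩
    have h := (hc.differentiable (by simp) 0).hasDerivAt
    have hf : HasDerivAt (fun t => (c t).1) (deriv c 0).1 0 :=
      (ContinuousLinearMap.fst ℝ E E).hasFDerivAt.comp_hasDerivAt (0 : ℝ) h
    have hg : HasDerivAt (fun t => (c t).2) (deriv c 0).2 0 :=
      (ContinuousLinearMap.snd ℝ E E).hasFDerivAt.comp_hasDerivAt (0 : ℝ) h
    have hS := fun t => (mem_tangentBundleOf_unitQuadric hs hp).1 (hcS t)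
    have h1 := (hasDerivAt_bilinear (B := B) hf hf).unique
      ((hasDerivAt_const (0 : ℝ) (1 : ℝ)).congr_of_eventuallyEq (.of_forall fun t => (hS t).1))
    have h2 := (hasDerivAt_bilinear (B := B) hf hg).unique
      ((hasDerivAt_const (0 : ℝ) (0 : ℝ)).congr_of_eventuallyEq (.of_forall fun t => (hS t).2))
    rw [hs] at h1
    exact ⟨by linarith, h2⟩
  · obtain ⟨q, v⟩ := x
    obtain ⟨ξ, η⟩ := w
    rintro ⟨hξ, hη⟩
    obtain ⟨hq, hv⟩ := (mem_tangentBundleOf_unitQuadric hs hp).1 hx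
    dsimp only at hξ hη hq hv
    set p : ℝ → E := fun t => radialProjection B (q + t • ξ) with hp_def
    have hpos := bilinear_add_smul_pos hs hp hq hξ
    have hpc : ContDiff ℝ ∞ p := contDiff_iff_contDiffAt.2 fun t =>
      ContDiffAt.comp (g := radialProjection B) t (contDiffAt_radialProjection (hpos t))
        (contDiff_add_smul q ξ).contDiffAt
    have hp0 : p 0 = q := by simpa [hp_def] using radialProjection_of_mem hq
    have hpm : ∀ t, B (p t) (p t) = 1 := fun t => radialProjection_mem (hpos t)
    have hpd : HasDerivAt p ξ 0 := hasDerivAt_radialProjection hs (hasDerivAt_add_smul q ξ 0)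
      (by simpa [unitQuadric] using hq) (by simpa using hξ)
    -- The affine path `v + t • η` is made tangent at `p t` by removing its normal component. The
    -- coefficient removed and its derivative both vanish at `0`, the latter by the linearised
    -- constraint `hη`, so the velocity is still `(ξ, η)`.
    refine ⟨fun t => (p t, v + t • η - B (p t) (v + t • η) • p t), ⟨?_, fun t => ?_, ?_⟩, ?_⟩
    · exact hpc.prodMk ((contDiff_add_smul v η).sub
        (((B.contDiff.comp hpc).clm_apply (contDiff_add_smul v η)).smul hpc))
    · refine (mem_tangentBundleOf_unitQuadric hs hp).2 ⟨hpm t, ?_⟩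
      simp [map_sub, hpm t]
    · simp [hp0, hv]
    · have h1 := hasDerivAt_bilinear (B := B) hpd (hasDerivAt_add_smul v η 0)
      have h2 := hpd.prodMk ((hasDerivAt_add_smul v η 0).fun_sub (h1.fun_smul hpd))
      rw [h2.deriv]
      simp [hp0, hv, hη]

end Quadric

/-! ### First variation of the action -/

section Variation

open Set Filter Topology MeasureTheory

/-- Differentiation under the integral sign for continuously differentiable integrands. -/
theorem hasDerivAt_intervalIntegral_of_contDiffOn {F : ℝ × ℝ → ℝ} {ε a b : ℝ} {J : Set ℝ}
    (hε : 0 < ε) (hJ : IsOpen J) (hab : a ≤ b) (hI : Icc a b ⊆ J)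
    (hF : ContDiffOn ℝ 1 F (Ioo (-ε) ε ×ˢ J)) :
    HasDerivAt (fun s => ∫ t in a..b, F (s, t)) (∫ t in a..b, fderiv ℝ F (0, t) (1, 0)) 0 := by
  have hU : IsOpen (Ioo (-ε) ε ×ˢ J) := isOpen_Ioo.prod hJ
  have hG : ContinuousOn (fun p => fderiv ℝ F p (1, 0)) (Ioo (-ε) ε ×ˢ J) :=
    (hF.continuousOn_fderiv_of_isOpen hU le_rfl).clm_apply continuousOn_const
  have hKU : Icc (-(ε / 2)) (ε / 2) ×ˢ Icc a b ⊆ Ioo (-ε) ε ×ˢ J :=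
    prod_mono (fun s hs => ⟨by linarith [hs.1], by linarith [hs.2]⟩) hI
  obtain ⟨C, hC⟩ := (isCompact_Icc.prod isCompact_Icc).exists_bound_of_continuousOn (hG.mono hKU)
  have hslice : ∀ {H : ℝ × ℝ → ℝ}, ContinuousOn H (Ioo (-ε) ε ×ˢ J) → ∀ s ∈ Ioo (-ε) ε,
      IntervalIntegrable (fun t => H (s, t)) volume a b := fun hH s hs => by
    refine ContinuousOn.intervalIntegrable_of_Icc hab ?_
    exact hH.comp (by fun_prop) fun t ht => ⟨hs, hI ht⟩
  have h0 : (0 : ℝ) ∈ Ioo (-ε) ε := ⟨by linarith, hε⟩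
  refine (intervalIntegral.hasDerivAt_integral_of_dominated_loc_of_deriv_le
    (s := Ioo (-(ε / 2)) (ε / 2)) (bound := fun _ => C)
    (F' := fun s t => fderiv ℝ F (s, t) (1, 0)) (Ioo_mem_nhds (by linarith) (by linarith))
    ?_ (hslice hF.continuousOn 0 h0) ?_ ?_ intervalIntegrable_const ?_).2
  · filter_upwards [isOpen_Ioo.mem_nhds h0] with s hs
    exact (hslice hF.continuousOn s hs).aestronglyMeasurable_restrict_uIoc
  · exact (hslice hG 0 h0).aestronglyMeasurable_restrict_uIoc
  · refine .of_forall fun t ht s hs => hC (s, t) ⟨Ioo_subset_Icc_self hs, ?_⟩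
    rw [uIoc_of_le hab] at ht
    exact Ioc_subset_Icc_self ht
  · refine .of_forall fun t ht s hs => ?_
    rw [uIoc_of_le hab] at ht
    have hmem : (s, t) ∈ Ioo (-ε) ε ×ˢ J :=
      hKU ⟨Ioo_subset_Icc_self hs, Ioc_subset_Icc_self ht⟩
    have h1 := ((hF.contDiffAt (hU.mem_nhds hmem)).differentiableAt one_ne_zero).hasFDerivAt
    exact h1.comp_hasDerivAt s ((hasDerivAt_id s).prodMk (hasDerivAt_const s t))

variable {E : Type*} [NormedAddCommGroup E] [NormedSpace ℝ E]

/-- The first variation formula. -/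
theorem hasDerivAt_action {L : E × E → ℝ} (hL : ContDiff ℝ ∞ L) {ε a b : ℝ} {J : Set ℝ}
    (hε : 0 < ε) (hJ : IsOpen J) (hab : a ≤ b) (hI : Icc a b ⊆ J) {Γ : ℝ → ℝ → E}
    (hΓ : ContDiffOn ℝ ∞ (fun p : ℝ × ℝ => Γ p.1 p.2) (Ioo (-ε) ε ×ˢ J)) {X : ℝ → E}
    (hX : ∀ t ∈ J, HasDerivAt (fun s => Γ s t) (X t) 0) :
    HasDerivAt (fun s => action L (Γ s) a b)
      (∫ t in a..b, fderiv ℝ L (Γ 0 t, deriv (Γ 0) t) (X t, deriv X t)) 0 := by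
  set Γ' : ℝ × ℝ → E := fun p => Γ p.1 p.2 with hΓ'
  have hU : IsOpen (Ioo (-ε) ε ×ˢ J) := isOpen_Ioo.prod hJ
  have h0 : (0 : ℝ) ∈ Ioo (-ε) ε := ⟨by linarith, hε⟩
  have hfd : ContDiffOn ℝ ∞ (fderiv ℝ Γ') (Ioo (-ε) ε ×ˢ J) := hΓ.fderiv_of_isOpen hU (by simp)
  have hD : ContDiffOn ℝ ∞ (fun p => fderiv ℝ Γ' p (0, 1)) (Ioo (-ε) ε ×ˢ J) :=
    hfd.clm_apply contDiffOn_const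
  have hder : ∀ s ∈ Ioo (-ε) ε, ∀ t ∈ J, deriv (Γ s) t = fderiv ℝ Γ' (s, t) (0, 1) := by
    intro s hs t ht
    have h1 := ((hΓ.contDiffAt (hU.mem_nhds (mk_mem_prod hs ht))).differentiableAt (by simp)).hasFDerivAt
    exact (h1.comp_hasDerivAt t ((hasDerivAt_const t s).prodMk (hasDerivAt_id t))).deriv
  have hXfd : ∀ t ∈ J, fderiv ℝ Γ' (0, t) (1, 0) = X t := by
    intro t ht
    have h1 := ((hΓ.contDiffAt (hU.mem_nhds (mk_mem_prod h0 ht))).differentiableAt (by simp)).hasFDerivAt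
    have h2 : HasDerivAt (fun s => Γ s t) (fderiv ℝ Γ' (0, t) (1, 0)) 0 :=
      HasFDerivAt.comp_hasDerivAt (f := fun s : ℝ => (s, t)) (0 : ℝ) h1
        ((hasDerivAt_id (0 : ℝ)).prodMk (hasDerivAt_const (0 : ℝ) t))
    exact h2.unique (hX t ht)
  have hF : ContDiffOn ℝ ∞ (fun p => L (Γ' p, fderiv ℝ Γ' p (0, 1))) (Ioo (-ε) ε ×ˢ J) :=
    hL.comp_contDiffOn (hΓ.prodMk hD)
  have key := hasDerivAt_intervalIntegral_of_contDiffOn hε hJ hab hI (hF.of_le (by simp))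
  refine (key.congr_of_eventuallyEq ?_).congr_deriv ?_
  · filter_upwards [isOpen_Ioo.mem_nhds h0] with s hs
    refine intervalIntegral.integral_congr fun t ht => ?_
    rw [uIcc_of_le hab] at ht
    simp only [hder s hs t (hI ht), hΓ']
  · refine intervalIntegral.integral_congr fun t ht => ?_
    rw [uIcc_of_le hab] at ht
    have hmem : ((0 : ℝ), t) ∈ Ioo (-ε) ε ×ˢ J := ⟨h0, hI ht⟩
    have hΓt := hΓ.contDiffAt (hU.mem_nhds hmem)
    have h1 := (hΓt.differentiableAt (by simp)).hasFDerivAt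
    have h2 := ((hfd.contDiffAt (hU.mem_nhds hmem)).differentiableAt (by simp)).hasFDerivAt
    have h3 := h2.clm_apply (hasFDerivAt_const ((0 : ℝ), (1 : ℝ)) ((0 : ℝ), t))
    have h4 := (((hL.differentiable (by simp)) (Γ' (0, t),
      fderiv ℝ Γ' (0, t) (0, 1))).hasFDerivAt).comp ((0 : ℝ), t) (h1.prodMk h3)
    -- Mixed partial derivatives commute, so the variation of the velocity is the time derivative of
    -- the variation field `X`.
    have hsymm : IsSymmSndFDerivAt ℝ Γ' (0, t) := hΓt.isSymmSndFDerivAt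
      (by rw [minSmoothness_of_isRCLikeNormedField]; exact WithTop.coe_le_coe.2 le_top)
    have hX' : deriv X t = fderiv ℝ (fderiv ℝ Γ') (0, t) (0, 1) (1, 0) := by
      have h5 := (h2.clm_apply (hasFDerivAt_const ((1 : ℝ), (0 : ℝ)) ((0 : ℝ), t))).comp_hasDerivAt
        t ((hasDerivAt_const t (0 : ℝ)).prodMk (hasDerivAt_id t))
      have h6 : X =ᶠ[𝓝 t] (fun p => fderiv ℝ Γ' p (1, 0)) ∘ fun τ => ((0 : ℝ), τ) := by
        filter_upwards [hJ.mem_nhds (hI ht)] with τ hτ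
        exact (hXfd τ hτ).symm
      rw [h6.deriv_eq, h5.deriv]
      simp
    have h7 : fderiv ℝ (fun p => L (Γ' p, fderiv ℝ Γ' p (0, 1))) (0, t) = _ := h4.fderiv
    simp only [h7, hder 0 h0 t (hI ht), hX', hsymm.eq (0, 1) (1, 0), ← hXfd t (hI ht)]
    simp [hΓ']

/-- A form of the du Bois-Reymond lemma. -/
theorem eq_of_forall_integral_deriv_mul_eq_zero {f : ℝ → ℝ} {J : Set ℝ} (hJ : IsOpen J)
    (hJc : J.OrdConnected) (hf : ContDiffOn ℝ ∞ f J) {a b : ℝ} (ha : a ∈ J) (hb : b ∈ J)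
    (hab : a < b) (h : ∀ χ : ℝ → ℝ, ContDiffOn ℝ ∞ χ J → χ a = 0 → χ b = 0 →
      ∫ t in a..b, deriv χ t * f t = 0) : f a = f b := by
  set m : ℝ := (∫ t in a..b, f t) / (b - a) with hm
  have hint : ∀ s ∈ J, ∀ t ∈ J, IntervalIntegrable (fun τ => f τ - m) volume s t :=
    fun s hs t ht => ((hf.continuousOn.sub continuousOn_const).mono
      (hJc.uIcc_subset hs ht)).intervalIntegrable
  -- Because `m` is the mean of `f`, this primitive vanishes at both ends and is an admissible test
  -- function. With it, `∫ (f - m) f = 0`; since also `∫ (f - m) = 0`, it follows that `∫ (f - m)² =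
  -- 0`.
  set χ : ℝ → ℝ := fun t => ∫ τ in a..t, (f τ - m) with hχ
  have hχd : ∀ t ∈ J, HasDerivAt χ (f t - m) t := fun t ht =>
    intervalIntegral.integral_hasDerivAt_right (hint a ha t ht)
      ((hf.continuousOn.sub continuousOn_const).stronglyMeasurableAtFilter hJ t ht)
      ((hf.continuousOn.sub continuousOn_const).continuousAt (hJ.mem_nhds ht))
  have hχs : ContDiffOn ℝ ∞ χ J := (contDiffOn_infty_iff_deriv_of_isOpen hJ).2
    ⟨fun t ht => (hχd t ht).differentiableAt.differentiableWithinAt,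
      (hf.sub contDiffOn_const).congr fun t ht => (hχd t ht).deriv⟩
  have hI : Icc a b ⊆ J := hJc.out ha hb
  have hfi : IntervalIntegrable f volume a b :=
    (hf.continuousOn.mono hI).intervalIntegrable_of_Icc hab.le
  have hχb : χ b = 0 := by
    have : b - a ≠ 0 := by linarith
    simp only [hχ]
    rw [intervalIntegral.integral_sub hfi intervalIntegrable_const, intervalIntegral.integral_const,
      smul_eq_mul, hm]
    field_simp
    ring
  have h1 := h χ hχs (by simp [hχ]) hχb
  have h2 : ∫ t in a..b, (f t - m) * f t = 0 := by
    rw [← h1]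
    refine intervalIntegral.integral_congr fun t ht => ?_
    rw [uIcc_of_le hab.le] at ht
    simp only [(hχd t (hI ht)).deriv]
  have hcf : ContinuousOn f (Icc a b) := hf.continuousOn.mono hI
  have h3 : ∫ t in a..b, (f t - m) ^ 2 = 0 := by
    have h4 : ∀ t, (f t - m) ^ 2 = (f t - m) * f t - (f t - m) * m := fun t => by ring
    simp only [h4]
    rw [intervalIntegral.integral_sub, h2, intervalIntegral.integral_mul_const]
    · have : ∫ t in a..b, (f t - m) = 0 := hχb
      rw [this]
      simp
    · exact ContinuousOn.intervalIntegrable_of_Icc hab.le (by fun_prop)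
    · exact ContinuousOn.intervalIntegrable_of_Icc hab.le (by fun_prop)
  have h5 : ∀ t ∈ Icc a b, f t = m := by
    intro t ht
    by_contra hne
    have : 0 < ∫ t in a..b, (f t - m) ^ 2 :=
      intervalIntegral.integral_pos hab (by fun_prop) (fun _ _ => sq_nonneg _)
        ⟨t, ht, by have := sub_ne_zero.2 hne; positivity⟩
    linarith
  rw [h5 a (left_mem_Icc.2 hab.le), h5 b (right_mem_Icc.2 hab.le)]

variable {B : E →L[ℝ] E →L[ℝ] ℝ}

/-- Weak Euler–Lagrange equation on a unit quadric. -/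
theorem IsEulerLagrangeCurve.integral_fderiv_eq_zero (hs : ∀ v w, B v w = B w v)
    (hp : ∀ v, v ≠ 0 → 0 < B v v) {L' L : E × E → ℝ} (hL : ContDiff ℝ ∞ L)
    (hLL' : ∀ q ∈ unitQuadric B, ∀ v, L' (q, v) = L (q, v)) {J : Set ℝ} (hJ : IsOpen J) {γ : ℝ → E}
    (hγ : IsEulerLagrangeCurve (unitQuadric B) L' J γ) {a b : ℝ} (hab : a < b)
    (hI : Icc a b ⊆ J) {X : ℝ → E} (hX : ContDiffOn ℝ ∞ X J) (hXt : ∀ t ∈ J, B (γ t) (X t) = 0)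
    (hXa : X a = 0) (hXb : X b = 0) :
    ∫ t in a..b, fderiv ℝ L (γ t, deriv γ t) (X t, deriv X t) = 0 := by
  obtain ⟨hγs, hγM, hcrit⟩ := hγ
  have hpos : ∀ t ∈ J, ∀ s : ℝ, 0 < B (γ t + s • X t) (γ t + s • X t) := fun t ht s =>
    bilinear_add_smul_pos hs hp (hγM t ht) (hXt t ht) s
  -- Projecting `γ + s X` gives competitors inside the quadric. Tangency of `X` keeps the projection
  -- defined and makes `X` the exact variation field.
  set Γ : ℝ → ℝ → E := fun s t => radialProjection B (γ t + s • X t) with hΓ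
  have hJ' : ∀ p ∈ Ioo (-1 : ℝ) 1 ×ˢ J, p.2 ∈ J := fun p hp => hp.2
  have hΓs : ContDiffOn ℝ ∞ (fun p : ℝ × ℝ => Γ p.1 p.2) (Ioo (-1 : ℝ) 1 ×ˢ J) := fun p hp =>
    ContDiffAt.comp_contDiffWithinAt (g := radialProjection B) p
      (contDiffAt_radialProjection (hpos p.2 hp.2 p.1)) (((hγs.comp contDiffOn_snd hJ').add (contDiffOn_fst.smul (hX.comp contDiffOn_snd hJ'))) p hp)
  have hΓ0 : ∀ t ∈ J, Γ 0 t = γ t := fun t ht => by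
    simpa [hΓ] using radialProjection_of_mem (hγM t ht)
  have hend : ∀ t ∈ J, X t = 0 → ∀ s, Γ s t = γ t := fun t ht h s => by
    simpa [hΓ, h] using radialProjection_of_mem (hγM t ht)
  have hΓM : ∀ s, ∀ t ∈ J, Γ s t ∈ unitQuadric B := fun s t ht => radialProjection_mem (hpos t ht s)
  have h1 := hcrit a b hab hI 1 Γ one_pos hΓs (fun s _ => hΓM s) hΓ0
    fun s _ => ⟨hend a (hI (left_mem_Icc.2 hab.le)) hXa s,
      hend b (hI (right_mem_Icc.2 hab.le)) hXb s⟩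
  -- `L'` is controlled only over the quadric. All competitors lie there, so its smooth extension
  -- `L` has the same action.
  have h2 : (fun s => action L' (Γ s) a b) = fun s => action L (Γ s) a b := by
    ext s
    refine intervalIntegral.integral_congr fun t ht => ?_
    rw [uIcc_of_le hab.le] at ht
    exact hLL' _ (hΓM s t (hI ht)) _
  rw [h2] at h1
  have h3 := (hasDerivAt_action hL one_pos hJ hab.le hI hΓs (X := X) fun t ht =>
    hasDerivAt_radialProjection hs (hasDerivAt_add_smul (γ t) (X t) 0)
      (by simpa using hγM t ht) (by simpa using hXt t ht)).unique h1
  rw [← h3]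
  refine intervalIntegral.integral_congr fun t ht => ?_
  rw [uIcc_of_le hab.le] at ht
  have h4 : Γ 0 =ᶠ[𝓝 t] γ := by
    filter_upwards [hJ.mem_nhds (hI ht)] with τ hτ using hΓ0 τ hτ
  simp only [h4.deriv_eq, hΓ0 t (hI ht)]

/-- **Noether's theorem** on a unit quadric: a tangent field `Y` along an Euler–Lagrange curve
which changes the Lagrangian by a total derivative `K'` yields a conserved quantity. -/
theorem IsEulerLagrangeCurve.noether (hs : ∀ v w, B v w = B w v)
    (hp : ∀ v, v ≠ 0 → 0 < B v v) {L' L : E × E → ℝ} (hL : ContDiff ℝ ∞ L)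
    (hLL' : ∀ q ∈ unitQuadric B, ∀ v, L' (q, v) = L (q, v)) {J : Set ℝ} (hJ : IsOpen J)
    (hJc : J.OrdConnected) {γ : ℝ → E}
    (hγ : IsEulerLagrangeCurve (unitQuadric B) L' J γ) {Y : ℝ → E} (hY : ContDiffOn ℝ ∞ Y J)
    (hYt : ∀ t ∈ J, B (γ t) (Y t) = 0) {K : ℝ → ℝ}
    (hK : ∀ t ∈ J, HasDerivAt K (fderiv ℝ L (γ t, deriv γ t) (Y t, deriv Y t)) t) {s t : ℝ}
    (hsJ : s ∈ J) (htJ : t ∈ J) :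
    fderiv ℝ L (γ s, deriv γ s) (0, Y s) - K s = fderiv ℝ L (γ t, deriv γ t) (0, Y t) - K t := by
  have hγ' : ContDiffOn ℝ ∞ (deriv γ) J := ((contDiffOn_infty_iff_deriv_of_isOpen hJ).1 hγ.1).2
  have hY' : ContDiffOn ℝ ∞ (deriv Y) J := ((contDiffOn_infty_iff_deriv_of_isOpen hJ).1 hY).2
  have hdL : ContDiffOn ℝ ∞ (fun t => fderiv ℝ L (γ t, deriv γ t)) J :=
    (hL.fderiv_right (m := ∞) (by simp)).comp_contDiffOn (hγ.1.prodMk hγ')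
  have hp' : ContDiffOn ℝ ∞ (fun t => fderiv ℝ L (γ t, deriv γ t) (0, Y t)) J :=
    hdL.clm_apply (contDiffOn_const.prodMk hY)
  have hK' : ContDiffOn ℝ ∞ (fun t => fderiv ℝ L (γ t, deriv γ t) (Y t, deriv Y t)) J :=
    hdL.clm_apply (hY.prodMk hY')
  have hKs : ContDiffOn ℝ ∞ K J := (contDiffOn_infty_iff_deriv_of_isOpen hJ).2
    ⟨fun t ht => (hK t ht).differentiableAt.differentiableWithinAt,
      hK'.congr fun t ht => (hK t ht).deriv⟩
  have main : ∀ a ∈ J, ∀ b ∈ J, a < b →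
      fderiv ℝ L (γ a, deriv γ a) (0, Y a) - K a =
        fderiv ℝ L (γ b, deriv γ b) (0, Y b) - K b := by
    intro a ha b hb hab
    have hI : Icc a b ⊆ J := hJc.out ha hb
    refine eq_of_forall_integral_deriv_mul_eq_zero (f := fun t =>
      fderiv ℝ L (γ t, deriv γ t) (0, Y t) - K t) hJ hJc (hp'.sub hKs) ha hb hab
      fun χ hχ hχa hχb => ?_
    have hχ' : ContDiffOn ℝ ∞ (deriv χ) J := ((contDiffOn_infty_iff_deriv_of_isOpen hJ).1 hχ).2
    have hd : ∀ {f : ℝ → ℝ}, ContDiffOn ℝ ∞ f J → ∀ t ∈ J, HasDerivAt f (deriv f t) t := fun hf t ht =>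
      ((hf.contDiffAt (hJ.mem_nhds ht)).differentiableAt (by simp)).hasDerivAt
    -- The variation is `χ Y` with `χ` vanishing at the ends. Its integrand is `χ K' + χ' p`, where
    -- `p` is the momentum paired with `Y`. Integrating `χ K'` by parts leaves `∫ χ' (p - K) = 0`
    -- for every such `χ`.
    have h1 := hγ.integral_fderiv_eq_zero hs hp hL hLL' hJ hab hI (hχ.smul hY)
      (fun t ht => by simp [hYt t ht]) (by simp [hχa]) (by simp [hχb])
    have h2 : ∫ t in a..b, (deriv χ t * K t + χ t * deriv K t) = 0 := by
      rw [intervalIntegral.integral_deriv_mul_eq_sub (fun t ht => hd hχ t ?_)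
        (fun t ht => hd hKs t ?_), hχa, hχb]
      · simp
      · exact ((hχ'.continuousOn.mono hI).intervalIntegrable_of_Icc hab.le)
      · exact ((((contDiffOn_infty_iff_deriv_of_isOpen hJ).1 hKs).2.continuousOn.mono
          hI).intervalIntegrable_of_Icc hab.le)
      all_goals
        rw [uIcc_of_le hab.le] at ht
        exact hI ht
    have hcont : ∀ {f : ℝ → ℝ}, ContDiffOn ℝ ∞ f J → ContinuousOn f (Icc a b) := fun hf =>
      hf.continuousOn.mono hI
    have hc1 := hcont hχ
    have hc2 := hcont hχ'
    have hc3 := hcont hKs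
    have hc4 := hcont hp'
    have hc5 := hcont hK'
    have h3 : ∫ t in a..b, (χ t * fderiv ℝ L (γ t, deriv γ t) (Y t, deriv Y t) +
        deriv χ t * fderiv ℝ L (γ t, deriv γ t) (0, Y t)) = 0 := by
      rw [← h1]
      refine intervalIntegral.integral_congr fun t ht => ?_
      rw [uIcc_of_le hab.le] at ht
      have hder : deriv (χ • Y) t = χ t • deriv Y t + deriv χ t • Y t :=
        ((hd hχ t (hI ht)).smul
          ((hY.contDiffAt (hJ.mem_nhds (hI ht))).differentiableAt (by simp)).hasDerivAt).deriv
      have hsplit : ((χ t • Y t, χ t • deriv Y t + deriv χ t • Y t) : E × E) =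
          χ t • (Y t, deriv Y t) + deriv χ t • ((0 : E), Y t) := by simp
      simp only [Pi.smul_apply', hder, hsplit, map_add, map_smul, smul_eq_mul]
    have h4 : ∫ t in a..b, (deriv χ t * K t +
        χ t * fderiv ℝ L (γ t, deriv γ t) (Y t, deriv Y t)) = 0 := by
      rw [← h2]
      refine intervalIntegral.integral_congr fun t ht => ?_
      rw [uIcc_of_le hab.le] at ht
      simp only [(hK t (hI ht)).deriv]
    have h5 := intervalIntegral.integral_sub (μ := volume) (a := a) (b := b)
      (ContinuousOn.intervalIntegrable_of_Icc hab.le ((hc1.mul hc5).add (hc2.mul hc4)))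
      (ContinuousOn.intervalIntegrable_of_Icc hab.le ((hc2.mul hc3).add (hc1.mul hc5)))
    simp only [Pi.add_apply, Pi.mul_apply] at h5
    rw [h3, h4, sub_zero] at h5
    rw [← h5]
    exact intervalIntegral.integral_congr fun t _ => by ring
  rcases lt_trichotomy s t with h | rfl | h
  · exact main s hsJ t htJ h
  · rfl
  · exact (main t htJ s hsJ h).symm

end Variation

/-! ### Twisted symplectic forms and Hamiltonian vectors -/

section Twisted

variable {E : Type*} [NormedAddCommGroup E] [NormedSpace ℝ E]

theorem extDeriv_ofSubsingleton {φ : E → E →L[ℝ] ℝ} {x : E} (hφ : DifferentiableAt ℝ φ x)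
    (v w : E) :
    extDeriv (fun y => ContinuousAlternatingMap.ofSubsingleton ℝ E ℝ (0 : Fin 1) (φ y)) x ![v, w] =
      fderiv ℝ φ x v w - fderiv ℝ φ x w v := by
  have h1 : DifferentiableAt ℝ
      (fun y => ContinuousAlternatingMap.ofSubsingleton ℝ E ℝ (0 : Fin 1) (φ y)) x :=
    (ContinuousAlternatingMap.ofSubsingletonLIE (𝕜 := ℝ) (E := E) (F := ℝ)
      (0 : Fin 1)).differentiableAt.comp x hφ
  have h2 : ∀ u u' : E, fderiv ℝ (fun y => φ y u) x u' = fderiv ℝ φ x u' u := fun u u' => by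
    rw [fderiv_clm_apply hφ (differentiableAt_const u)]
    simp
  rw [extDeriv_apply h1, Fin.sum_univ_two]
  simp [Fin.removeNth, h2, sub_eq_add_neg]

theorem hasFDerivAt_bilinear_comp {F : Type*} [NormedAddCommGroup F] [NormedSpace ℝ F]
    (P : E →L[ℝ] E →L[ℝ] ℝ) (l m : F →L[ℝ] E) (x : F) :
    HasFDerivAt (fun y => P (l y) (m y)) ((P (l x)).comp m + ((P.comp l).flip (m x))) x :=
  (P.comp l).hasFDerivAt.clm_apply m.hasFDerivAt

/-- Positivity makes `v ↦ P v` injective into the dual, and equality of dimensions makes it onto. It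
supplies the force term and the normal direction in the Hamiltonian vector of the energy. -/
theorem exists_bilinear_apply_eq [FiniteDimensional ℝ E] {P : E →L[ℝ] E →L[ℝ] ℝ}
    (hp : ∀ v, v ≠ 0 → 0 < P v v) (ℓ : E →L[ℝ] ℝ) : ∃ u, P u = ℓ := by
  let T : E →ₗ[ℝ] Module.Dual ℝ E :=
    (ContinuousLinearMap.coeLM ℝ).comp P.toLinearMap
  have hT : Function.Injective T := by
    refine (injective_iff_map_eq_zero T).2 fun v hv => ?_
    by_contra hne
    have h0 : P v v = 0 := LinearMap.congr_fun hv v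
    exact (hp v hne).ne' h0
  obtain ⟨u, hu⟩ := (LinearMap.injective_iff_surjective_of_finrank_eq_finrank
    Subspace.dual_finrank_eq.symm).1 hT ℓ.toLinearMap
  exact ⟨u, ContinuousLinearMap.ext fun w => LinearMap.congr_fun hu w⟩

namespace MagneticSystem

theorem hasDerivAt_comp_of_eqOn {S : Set E} {F G : E → ℝ} {x : E}
    (hG : DifferentiableAt ℝ G x) (h : Set.EqOn F G S) {c : ℝ → E} (hc : IsCurveThrough S x c) :
    HasDerivAt (fun t => F (c t)) (fderiv ℝ G x (deriv c 0)) 0 := by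
  obtain ⟨hcs, hcS, rfl⟩ := hc
  have h1 := hG.hasFDerivAt.comp_hasDerivAt (0 : ℝ) (hcs.differentiable (by simp) 0).hasDerivAt
  exact h1.congr_of_eventuallyEq (.of_forall fun t => h (hcS t))

/-- Only derivatives along curves in the phase space matter, so they may be computed from any
differentiable extension of `F`. -/
theorem isHamiltonianVector_of_eqOn (S : MagneticSystem E) {F G : E × E → ℝ} {x X : E × E}
    (hG : DifferentiableAt ℝ G x) (h : Set.EqOn F G S.TM) (hX : X ∈ tangentVectors S.TM x)
    (hω : ∀ W ∈ tangentVectors S.TM x, fderiv ℝ G x W = -S.twistedForm x ![X, W]) :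
    S.IsHamiltonianVector F x X :=
  ⟨hX, fun c hc => (hasDerivAt_comp_of_eqOn hG h hc).congr_deriv (hω _ ⟨c, hc, rfl⟩)⟩

end MagneticSystem

end Twisted

/-! ### Weighted Hermitian structures and rotations -/

section Weighted

variable {n : ℕ}

theorem weightedPotential_apply (a : Fin n → ℝ) (v w : CSpace n) :
    weightedPotential a v w = (1 / 2) * (weightedInner a v w).im := rfl

theorem weightedPotential_antisymm (a : Fin n → ℝ) (v w : CSpace n) :
    weightedPotential a v w = -weightedPotential a w v := by
  simp only [weightedPotential_apply, weightedInner_eq, Complex.im_sum, ← mul_neg,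
    ← Finset.sum_neg_distrib]
  congr 1
  refine Finset.sum_congr rfl fun j _ => ?_
  rw [Complex.im_ofReal_mul, Complex.im_ofReal_mul, Complex.mul_im, Complex.mul_im]
  simp only [Complex.conj_re, Complex.conj_im]
  ring

/-- The angular vector field `∂_{φ_j}` as a linear map. -/
noncomputable def angularMap (j : Fin n) : CSpace n →L[ℝ] CSpace n :=
  LinearMap.toContinuousLinearMap
    { toFun := angularField j
      map_add' := fun v w => by ext k; by_cases h : k = j <;> simp [angularField, h, mul_add]
      map_smul' := fun r v => by
        ext k; by_cases h : k = j <;> simp [angularField, h, mul_left_comm] }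

theorem angularMap_apply (j : Fin n) (v : CSpace n) : angularMap j v = angularField j v := rfl

theorem angularMap_comm (j k : Fin n) (v : CSpace n) :
    angularMap j (angularMap k v) = angularMap k (angularMap j v) := by
  by_cases h : j = k
  · rw [h]
  · ext l
    by_cases hj : l = j <;> by_cases hk : l = k <;>
      simp [angularMap_apply, angularField, h, Ne.symm h, hj, hk]

theorem weightedInner_angularMap_right (a : Fin n → ℝ) (j : Fin n) (v w : CSpace n) :
    weightedInner a v (angularMap j w) = a j * (starRingEnd ℂ (v j) * (Complex.I * w j)) := by
  rw [weightedInner_eq, Finset.sum_eq_single j]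
  · simp [angularMap_apply, angularField]
  · intro k _ hk
    simp [angularMap_apply, angularField, hk]
  · simp

theorem weightedInner_angularMap_left (a : Fin n → ℝ) (j : Fin n) (v w : CSpace n) :
    weightedInner a (angularMap j v) w = -weightedInner a v (angularMap j w) := by
  rw [weightedInner_angularMap_right, weightedInner_eq, Finset.sum_eq_single j]
  · simp [angularMap_apply, angularField]
    exact Or.inl (by ring)
  · intro k _ hk
    simp [angularMap_apply, angularField, hk]
  · simp

theorem weightedMetric_angularMap_left (a : Fin n → ℝ) (j : Fin n) (v w : CSpace n) :
    weightedMetric a (angularMap j v) w = -weightedMetric a v (angularMap j w) := by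
  simp [weightedMetric_apply, weightedInner_angularMap_left]

theorem weightedPotential_angularMap_left (a : Fin n → ℝ) (j : Fin n) (v w : CSpace n) :
    weightedPotential a (angularMap j v) w = -weightedPotential a v (angularMap j w) := by
  simp [weightedPotential_apply, weightedInner_angularMap_left]

/-- The generator is skew for a symmetric form. Since the weights are arbitrary, the angular fields
are tangent to every weighted quadric. -/
theorem weightedMetric_self_angularMap (a : Fin n → ℝ) (j : Fin n) (v : CSpace n) :
    weightedMetric a v (angularMap j v) = 0 := by
  have h1 := weightedMetric_angularMap_left a j v v
  rw [weightedMetric_symm] at h1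
  linarith

/-- Moving the commuting skew generators across shows that the value is symmetric in `j` and `k`,
while the potential is antisymmetric. Thus the torus orbits are isotropic for the magnetic field. -/
theorem weightedPotential_angularMap_angularMap (a : Fin n → ℝ) (j k : Fin n) (v : CSpace n) :
    weightedPotential a (angularMap j v) (angularMap k v) = 0 := by
  have h1 := weightedPotential_angularMap_left a j v (angularMap k v)
  have h2 := weightedPotential_angularMap_left a k v (angularMap j v)
  have h3 := weightedPotential_antisymm a (angularMap j v) (angularMap k v)
  rw [angularMap_comm] at h1
  linarith

/-- The closed form of the conjugate momenta. -/
noncomputable def angularMomentum (a : Fin n → ℝ) (j : Fin n) (x : CSpace n × CSpace n) : ℝ :=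
  weightedMetric a x.2 (angularMap j x.1) - weightedPotential a x.1 (angularMap j x.1)

variable (M : Set (CSpace n)) (a : Fin n → ℝ) (ha : ∀ j, 0 < a j)

theorem weightedSystem_lagrangian (V : CSpace n → ℝ) (x : CSpace n × CSpace n) :
    (weightedSystem M a ha).lagrangian V x =
      1 / 2 * weightedMetric a x.2 x.2 - weightedPotential a x.1 x.2 - V x.1 := rfl

theorem weightedSystem_energy (V : CSpace n → ℝ) (x : CSpace n × CSpace n) :
    (weightedSystem M a ha).energy V x = 1 / 2 * weightedMetric a x.2 x.2 + V x.1 := rfl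

theorem conjugateMomentum_weightedSystem (V : CSpace n → ℝ) (j : Fin n) :
    conjugateMomentum ((weightedSystem M a ha).lagrangian V) j = angularMomentum a j := by
  ext x
  have h1 := hasDerivAt_add_smul x.2 (angularField j x.1) 0
  have h2 := (((hasDerivAt_bilinear (B := weightedMetric a) h1 h1).const_mul (1 / 2)).sub
    ((weightedPotential a x.1).hasFDerivAt.comp_hasDerivAt (0 : ℝ) h1)).sub_const (V x.1)
  refine h2.deriv.trans ?_
  simp only [zero_smul, add_zero, angularMomentum, angularMap_apply,
    weightedMetric_symm a (angularField j x.1) x.2]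
  ring

theorem twistedForm_weightedSystem (x X W : CSpace n × CSpace n) :
    (weightedSystem M a ha).twistedForm x ![X, W] =
      weightedMetric a X.2 W.1 - weightedMetric a W.2 X.1 - 2 * weightedPotential a X.1 W.1 := by
  -- The Liouville form and the potential both depend linearly on the base point, so each exterior
  -- derivative is a constant antisymmetrisation. For the antisymmetric potential this produces the
  -- factor `2`.
  let Λ : CSpace n × CSpace n →L[ℝ] (CSpace n × CSpace n) →L[ℝ] ℝ :=
    ((ContinuousLinearMap.compL ℝ (CSpace n × CSpace n) (CSpace n) ℝ).flip
      (ContinuousLinearMap.fst ℝ _ _)).comp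
      ((weightedMetric a).comp (ContinuousLinearMap.snd ℝ _ _))
  have h1 : extDeriv (weightedSystem M a ha).liouvilleForm x ![X, W] = Λ X W - Λ W X := by
    have h := extDeriv_ofSubsingleton (φ := Λ) (x := x) Λ.differentiableAt X W
    rw [Λ.fderiv] at h
    exact h
  have h2 : extDeriv (weightedSystem M a ha).potentialForm x.1 ![X.1, W.1] =
      weightedPotential a X.1 W.1 - weightedPotential a W.1 X.1 := by
    have h := extDeriv_ofSubsingleton (φ := weightedPotential a) (x := x.1)
      (weightedPotential a).differentiableAt X.1 W.1
    rw [(weightedPotential a).fderiv] at h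
    exact h
  have h3 : (ContinuousLinearMap.fst ℝ (CSpace n) (CSpace n) : _ → _) ∘ ![X, W] =
      ![X.1, W.1] := by
    ext i : 1
    fin_cases i <;> rfl
  rw [MagneticSystem.twistedForm, ContinuousAlternatingMap.sub_apply, h1,
    ContinuousAlternatingMap.compContinuousLinearMap_apply, h3, h2,
    weightedPotential_antisymm a W.1 X.1]
  change weightedMetric a X.2 W.1 - weightedMetric a W.2 X.1 - _ = _
  ring

theorem contDiff_angularMomentum (j : Fin n) : ContDiff ℝ ∞ (angularMomentum a j) := by
  have h1 : ContDiff ℝ ∞ fun x : CSpace n × CSpace n => angularMap j x.1 :=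
    (angularMap j).contDiff.comp contDiff_fst
  exact (((weightedMetric a).contDiff.comp contDiff_snd).clm_apply h1).sub
    (((weightedPotential a).contDiff.comp contDiff_fst).clm_apply h1)

theorem fderiv_angularMomentum (j : Fin n) (x W : CSpace n × CSpace n) :
    fderiv ℝ (angularMomentum a j) x W =
      weightedMetric a W.2 (angularMap j x.1) + weightedMetric a x.2 (angularMap j W.1) -
        2 * weightedPotential a x.1 (angularMap j W.1) := by
  have h1 := (hasFDerivAt_bilinear_comp (weightedMetric a) (ContinuousLinearMap.snd ℝ _ _)
    ((angularMap j).comp (ContinuousLinearMap.fst ℝ (CSpace n) (CSpace n))) x).sub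
    (hasFDerivAt_bilinear_comp (weightedPotential a) (ContinuousLinearMap.fst ℝ _ _)
    ((angularMap j).comp (ContinuousLinearMap.fst ℝ (CSpace n) (CSpace n))) x)
  have h2 : fderiv ℝ (angularMomentum a j) x = _ := h1.fderiv
  -- The two terms from differentiating the potential part coincide, by antisymmetry of the form and
  -- skewness of the generator.
  have h3 := weightedPotential_antisymm a W.1 (angularMap j x.1)
  rw [weightedPotential_angularMap_left] at h3
  rw [h2]
  simp [h3]
  ring

theorem contDiff_weightedSystem_lagrangian {G : CSpace n → ℝ} (hG : ContDiff ℝ ∞ G) :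
    ContDiff ℝ ∞ ((weightedSystem M a ha).lagrangian G) :=
  ((contDiff_const.mul (((weightedMetric a).contDiff.comp contDiff_snd).clm_apply
    contDiff_snd)).sub (((weightedPotential a).contDiff.comp contDiff_fst).clm_apply
    contDiff_snd)).sub (hG.comp contDiff_fst)

theorem fderiv_weightedSystem_lagrangian {G : CSpace n → ℝ} (hG : ContDiff ℝ ∞ G)
    (x W : CSpace n × CSpace n) :
    fderiv ℝ ((weightedSystem M a ha).lagrangian G) x W =
      weightedMetric a x.2 W.2 - weightedPotential a W.1 x.2 - weightedPotential a x.1 W.2 -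
        fderiv ℝ G x.1 W.1 := by
  have h1 := (((hasFDerivAt_bilinear_comp (weightedMetric a) (ContinuousLinearMap.snd ℝ _ _)
    (ContinuousLinearMap.snd ℝ (CSpace n) (CSpace n)) x).const_mul (1 / 2)).sub
    (hasFDerivAt_bilinear_comp (weightedPotential a) (ContinuousLinearMap.fst ℝ _ _)
    (ContinuousLinearMap.snd ℝ (CSpace n) (CSpace n)) x)).sub
    (((hG.differentiable (by simp)) x.1).hasFDerivAt.comp x
      (ContinuousLinearMap.fst ℝ (CSpace n) (CSpace n)).hasFDerivAt)
  have h2 : fderiv ℝ ((weightedSystem M a ha).lagrangian G) x = _ := h1.fderiv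
  rw [h2]
  simp [weightedMetric_symm a W.2 x.2]
  ring

theorem contDiff_weightedSystem_energy {G : CSpace n → ℝ} (hG : ContDiff ℝ ∞ G) :
    ContDiff ℝ ∞ ((weightedSystem M a ha).energy G) :=
  (contDiff_const.mul (((weightedMetric a).contDiff.comp contDiff_snd).clm_apply
    contDiff_snd)).add (hG.comp contDiff_fst)

theorem fderiv_weightedSystem_energy {G : CSpace n → ℝ} (hG : ContDiff ℝ ∞ G)
    (x W : CSpace n × CSpace n) :
    fderiv ℝ ((weightedSystem M a ha).energy G) x W =
      weightedMetric a x.2 W.2 + fderiv ℝ G x.1 W.1 := by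
  have h1 := ((hasFDerivAt_bilinear_comp (weightedMetric a) (ContinuousLinearMap.snd ℝ _ _)
    (ContinuousLinearMap.snd ℝ (CSpace n) (CSpace n)) x).const_mul (1 / 2)).add
    (((hG.differentiable (by simp)) x.1).hasFDerivAt.comp x
      (ContinuousLinearMap.fst ℝ (CSpace n) (CSpace n)).hasFDerivAt)
  have h2 : fderiv ℝ ((weightedSystem M a ha).energy G) x = _ := h1.fderiv
  rw [h2]
  simp [weightedMetric_symm a W.2 x.2]
  ring

end Weighted

/-! ### Integrability on weighted quadrics -/

section WeightedQuadric

open Set Filter Topology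

variable {n : ℕ} {a b : Fin n → ℝ}

theorem angularMap_mem_tangentVectors (hb : ∀ j, 0 < b j) (j : Fin n)
    {x : CSpace n × CSpace n} (hx : x ∈ tangentBundleOf (unitQuadric (weightedMetric b))) :
    (angularMap j x.1, angularMap j x.2) ∈
      tangentVectors (tangentBundleOf (unitQuadric (weightedMetric b))) x := by
  rw [mem_tangentVectors_tangentBundleOf_unitQuadric (weightedMetric_symm b)
    (weightedMetric_pos b hb) hx]
  refine ⟨weightedMetric_self_angularMap b j x.1, ?_⟩
  rw [weightedMetric_angularMap_left]
  simp

theorem momentaAndEnergy_castSucc (M : Set (CSpace n)) (ha : ∀ j, 0 < a j) (V : CSpace n → ℝ)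
    (j : Fin n) :
    momentaAndEnergy (weightedSystem M a ha) V j.castSucc = angularMomentum a j := by
  simp [momentaAndEnergy, conjugateMomentum_weightedSystem]

theorem momentaAndEnergy_last (M : Set (CSpace n)) (ha : ∀ j, 0 < a j) (V : CSpace n → ℝ) :
    momentaAndEnergy (weightedSystem M a ha) V (Fin.last n) =
      (weightedSystem M a ha).energy V := by
  simp [momentaAndEnergy]

theorem contDiff_momentaAndEnergy (M : Set (CSpace n)) (ha : ∀ j, 0 < a j) {G : CSpace n → ℝ}
    (hG : ContDiff ℝ ∞ G) (i : Fin (n + 1)) :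
    ContDiff ℝ ∞ (momentaAndEnergy (weightedSystem M a ha) G i) := by
  induction i using Fin.lastCases with
  | last => rw [momentaAndEnergy_last]; exact contDiff_weightedSystem_energy M a ha hG
  | cast j => rw [momentaAndEnergy_castSucc]; exact contDiff_angularMomentum a j

theorem eqOn_energy (M : Set (CSpace n)) (ha : ∀ j, 0 < a j) {V G : CSpace n → ℝ}
    (hV : EqOn V G M) :
    EqOn ((weightedSystem M a ha).energy V) ((weightedSystem M a ha).energy G)
      (weightedSystem M a ha).TM := fun x hx => by
  rw [weightedSystem_energy, weightedSystem_energy, hV hx.1]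

theorem eqOn_momentaAndEnergy (M : Set (CSpace n)) (ha : ∀ j, 0 < a j) {V G : CSpace n → ℝ}
    (hV : EqOn V G M) (i : Fin (n + 1)) :
    EqOn (momentaAndEnergy (weightedSystem M a ha) V i)
      (momentaAndEnergy (weightedSystem M a ha) G i) (weightedSystem M a ha).TM := by
  induction i using Fin.lastCases with
  | last => simpa only [momentaAndEnergy_last] using eqOn_energy M ha hV
  | cast j => simp only [momentaAndEnergy_castSucc]; exact fun _ _ => rfl

/-! ### Conservation along Euler–Lagrange curves. -/

variable (ha : ∀ j, 0 < a j) (hb : ∀ j, 0 < b j) {V G : CSpace n → ℝ} (hG : ContDiff ℝ ∞ G)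
  (hV : EqOn V G (unitQuadric (weightedMetric b)))
  (hGA : ∀ q ∈ unitQuadric (weightedMetric b), ∀ j, fderiv ℝ G q (angularMap j q) = 0)

include hb hG hV hGA in
theorem isIntegralOfMotion_angularMomentum (j : Fin n) :
    IsIntegralOfMotion (unitQuadric (weightedMetric b))
      ((weightedSystem (unitQuadric (weightedMetric b)) a ha).lagrangian V)
      (angularMomentum a j) := by
  intro J γ hJ hJc hγ s hs t ht
  have hLL' : ∀ q ∈ unitQuadric (weightedMetric b), ∀ v,
      (weightedSystem (unitQuadric (weightedMetric b)) a ha).lagrangian V (q, v) =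
        (weightedSystem (unitQuadric (weightedMetric b)) a ha).lagrangian G (q, v) :=
    fun q hq v => by
      rw [weightedSystem_lagrangian, weightedSystem_lagrangian, hV hq]
  -- Noether for the rotation field with `K = 0`: the metric term is zero by skewness, the two
  -- potential terms cancel, and `hGA` kills the derivative of `G`.
  have h1 := hγ.noether (weightedMetric_symm b) (weightedMetric_pos b hb)
    (contDiff_weightedSystem_lagrangian _ a ha hG) hLL' hJ hJc (Y := fun t => angularMap j (γ t))
    (K := fun _ => 0) ((angularMap j).contDiff.comp_contDiffOn hγ.1)
    (fun t _ => weightedMetric_self_angularMap b j (γ t)) (fun t ht => ?_) hs ht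
  · simpa [fderiv_weightedSystem_lagrangian _ a ha hG, angularMomentum] using h1
  · have hd := ((hγ.1.contDiffAt (hJ.mem_nhds ht)).differentiableAt (by simp)).hasDerivAt
    have hY : deriv (fun t => angularMap j (γ t)) t = angularMap j (deriv γ t) :=
      ((angularMap j).hasFDerivAt.comp_hasDerivAt t hd).deriv
    rw [fderiv_weightedSystem_lagrangian _ a ha hG, hY]
    dsimp only
    rw [weightedMetric_self_angularMap, weightedPotential_angularMap_left, hGA _ (hγ.2.1 t ht)]
    simpa using hasDerivAt_const t (0 : ℝ)

include hb hG hV in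
theorem isIntegralOfMotion_energy :
    IsIntegralOfMotion (unitQuadric (weightedMetric b))
      ((weightedSystem (unitQuadric (weightedMetric b)) a ha).lagrangian V)
      ((weightedSystem (unitQuadric (weightedMetric b)) a ha).energy V) := by
  intro J γ hJ hJc hγ s hs t ht
  have hLL' : ∀ q ∈ unitQuadric (weightedMetric b), ∀ v,
      (weightedSystem (unitQuadric (weightedMetric b)) a ha).lagrangian V (q, v) =
        (weightedSystem (unitQuadric (weightedMetric b)) a ha).lagrangian G (q, v) :=
    fun q hq v => by
      rw [weightedSystem_lagrangian, weightedSystem_lagrangian, hV hq]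
  have hγ' : ContDiffOn ℝ ∞ (deriv γ) J := ((contDiffOn_infty_iff_deriv_of_isOpen hJ).1 hγ.1).2
  have hd : ∀ t ∈ J, HasDerivAt γ (deriv γ t) t := fun t ht =>
    ((hγ.1.contDiffAt (hJ.mem_nhds ht)).differentiableAt (by simp)).hasDerivAt
  have hd' : ∀ t ∈ J, HasDerivAt (deriv γ) (deriv (deriv γ) t) t := fun t ht =>
    ((hγ'.contDiffAt (hJ.mem_nhds ht)).differentiableAt (by simp)).hasDerivAt
  have hL := contDiff_weightedSystem_lagrangian (unitQuadric (weightedMetric b)) a ha hG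
  have htan : ∀ t ∈ J, weightedMetric b (γ t) (deriv γ t) = 0 := fun t ht => by
    have h1 := (hasDerivAt_bilinear (B := weightedMetric b) (hd t ht) (hd t ht)).unique
      ((hasDerivAt_const t (1 : ℝ)).congr_of_eventuallyEq
        (by filter_upwards [hJ.mem_nhds ht] with τ hτ using hγ.2.1 τ hτ))
    rw [weightedMetric_symm] at h1
    linarith
  -- Noether for time translation: varying along the velocity changes `L` by its own time
  -- derivative, so `K = L`, and the momentum paired with the velocity minus `L` is the energy.
  have h1 := hγ.noether (weightedMetric_symm b) (weightedMetric_pos b hb) hL hLL' hJ hJc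
    (Y := deriv γ) (K := fun t =>
      (weightedSystem (unitQuadric (weightedMetric b)) a ha).lagrangian G (γ t, deriv γ t))
    hγ' htan (fun t ht => ((hL.differentiable (by simp)) _).hasFDerivAt.comp_hasDerivAt t
      ((hd t ht).prodMk (hd' t ht))) hs ht
  simp only [fderiv_weightedSystem_lagrangian _ a ha hG, weightedSystem_lagrangian, map_zero,
    zero_apply] at h1
  rw [weightedSystem_energy, weightedSystem_energy, hV (hγ.2.1 s hs), hV (hγ.2.1 t ht)]
  dsimp only
  linarith

/-! ### Hamiltonian vectors and Poisson brackets. -/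

include hb in
theorem isHamiltonianVector_angularMomentum (j : Fin n) {x : CSpace n × CSpace n}
    (hx : x ∈ tangentBundleOf (unitQuadric (weightedMetric b))) :
    (weightedSystem (unitQuadric (weightedMetric b)) a ha).IsHamiltonianVector
      (angularMomentum a j) x (angularMap j x.1, angularMap j x.2) := by
  refine MagneticSystem.isHamiltonianVector_of_eqOn _
    ((contDiff_angularMomentum a j).differentiable (by simp) x) (fun _ _ => rfl)
    (angularMap_mem_tangentVectors hb j hx) fun W _ => ?_
  rw [fderiv_angularMomentum, twistedForm_weightedSystem]
  dsimp only
  rw [weightedMetric_angularMap_left, weightedPotential_angularMap_left]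
  ring

include hb hG hV in
theorem exists_isHamiltonianVector_energy {x : CSpace n × CSpace n}
    (hx : x ∈ tangentBundleOf (unitQuadric (weightedMetric b))) :
    ∃ X, (weightedSystem (unitQuadric (weightedMetric b)) a ha).IsHamiltonianVector
        ((weightedSystem (unitQuadric (weightedMetric b)) a ha).energy V) x X ∧
      ∀ W ∈ tangentVectors (tangentBundleOf (unitQuadric (weightedMetric b))) x,
        (weightedSystem (unitQuadric (weightedMetric b)) a ha).twistedForm x ![X, W] =
          -(weightedMetric a x.2 W.2 + fderiv ℝ G x.1 W.1) := by
  have hs := weightedMetric_symm b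
  have hp := weightedMetric_pos b hb
  obtain ⟨hq, hv⟩ := (mem_tangentBundleOf_unitQuadric hs hp).1 hx
  -- `u` is the unconstrained acceleration, magnetic force minus gradient of `G`. The vector `ν`
  -- below is the normal to the quadric with respect to the metric with weights `a`.
  obtain ⟨u, hu⟩ := exists_bilinear_apply_eq (weightedMetric_pos a ha)
    ((2 : ℝ) • weightedPotential a x.2 - fderiv ℝ G x.1)
  obtain ⟨ν, hν⟩ := exists_bilinear_apply_eq (weightedMetric_pos a ha) (weightedMetric b x.1)
  have hν0 : weightedMetric b x.1 ν ≠ 0 := by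
    rw [← hν]
    refine (weightedMetric_pos a ha ν ?_).ne'
    rintro rfl
    rw [← hν] at hq
    simp at hq
  -- The Lagrange multiplier is fixed by tangency to the tangent bundle. The term `μ • ν` is
  -- invisible to the twisted form on tangent `W`, since it pairs with `W.1` as a multiple of
  -- `weightedMetric b x.1 W.1 = 0`.
  set μ : ℝ := -(weightedMetric b x.2 x.2 + weightedMetric b x.1 u) / weightedMetric b x.1 ν
    with hμ
  have hX : (x.2, u + μ • ν) ∈
      tangentVectors (tangentBundleOf (unitQuadric (weightedMetric b))) x := by
    rw [mem_tangentVectors_tangentBundleOf_unitQuadric hs hp hx]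
    refine ⟨hv, ?_⟩
    simp only [map_add, map_smul, smul_eq_mul, hμ]
    field_simp
    ring
  have hω : ∀ W ∈ tangentVectors (tangentBundleOf (unitQuadric (weightedMetric b))) x,
      (weightedSystem (unitQuadric (weightedMetric b)) a ha).twistedForm x
        ![(x.2, u + μ • ν), W] = -(weightedMetric a x.2 W.2 + fderiv ℝ G x.1 W.1) := by
    intro W hW
    have hW1 := ((mem_tangentVectors_tangentBundleOf_unitQuadric hs hp hx).1 hW).1
    rw [twistedForm_weightedSystem]
    simp only [map_add, map_smul, hu, hν, add_apply, smul_apply, sub_apply, smul_eq_mul, hW1,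
      weightedMetric_symm a W.2 x.2]
    ring
  refine ⟨(x.2, u + μ • ν), MagneticSystem.isHamiltonianVector_of_eqOn _
    ((contDiff_weightedSystem_energy _ a ha hG).differentiable (by simp) x)
    (eqOn_energy _ ha hV) hX fun W hW => ?_, hω⟩
  rw [hω W hW, fderiv_weightedSystem_energy _ a ha hG, neg_neg]

include hb hG hV hGA in
theorem poissonCommute_momentaAndEnergy (i k : Fin (n + 1)) :
    (weightedSystem (unitQuadric (weightedMetric b)) a ha).PoissonCommute
      (momentaAndEnergy (weightedSystem (unitQuadric (weightedMetric b)) a ha) V i)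
      (momentaAndEnergy (weightedSystem (unitQuadric (weightedMetric b)) a ha) V k) := by
  intro x hx
  obtain ⟨X, hX, hXω⟩ := exists_isHamiltonianVector_energy ha hb hG hV hx
  have hself : ∀ W, (weightedSystem (unitQuadric (weightedMetric b)) a ha).twistedForm x
      ![W, W] = 0 := fun W =>
    ContinuousAlternatingMap.map_eq_zero_of_eq _ _ (i := 0) (j := 1) rfl (by simp)
  -- Up to sign this is the derivative of the energy along the lifted rotation, which preserves the
  -- speed and `G` to first order.
  have hXE : ∀ j, (weightedSystem (unitQuadric (weightedMetric b)) a ha).twistedForm x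
      ![X, (angularMap j x.1, angularMap j x.2)] = 0 := fun j => by
    rw [hXω _ (angularMap_mem_tangentVectors hb j hx)]
    dsimp only
    rw [weightedMetric_self_angularMap, hGA _ hx.1]
    simp
  induction i using Fin.lastCases with
  | last =>
    induction k using Fin.lastCases with
    | last =>
      rw [momentaAndEnergy_last]
      exact ⟨X, X, hX, hX, hself X⟩
    | cast k =>
      rw [momentaAndEnergy_last, momentaAndEnergy_castSucc]
      exact ⟨X, _, hX, isHamiltonianVector_angularMomentum ha hb k hx, hXE k⟩
  | cast i =>
    induction k using Fin.lastCases with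
    | last =>
      rw [momentaAndEnergy_last, momentaAndEnergy_castSucc]
      refine ⟨_, X, isHamiltonianVector_angularMomentum ha hb i hx, hX, ?_⟩
      have h := hXE i
      rw [twistedForm_weightedSystem] at h ⊢
      have h' := weightedPotential_antisymm a X.1 (angularMap i x.1)
      dsimp only at h ⊢
      linarith
    | cast k =>
      rw [momentaAndEnergy_castSucc, momentaAndEnergy_castSucc]
      refine ⟨_, _, isHamiltonianVector_angularMomentum ha hb i hx,
        isHamiltonianVector_angularMomentum ha hb k hx, ?_⟩
      rw [twistedForm_weightedSystem]
      dsimp only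
      rw [weightedPotential_angularMap_angularMap, weightedMetric_angularMap_left,
        weightedMetric_angularMap_left, angularMap_comm]
      ring

/-! ### Density of the regular points and functional independence. -/

/-- The points `(z, v)` at which all `z_j` are nonzero and `v` is not purely angular. -/
def regularPoints (n : ℕ) : Set (CSpace n × CSpace n) :=
  {x | (∀ j, x.1 j ≠ 0) ∧ ∃ j, (starRingEnd ℂ (x.1 j) * x.2 j).re ≠ 0}

theorem isOpen_regularPoints : IsOpen (regularPoints n) := by
  have h1 : ∀ j, Continuous fun x : CSpace n × CSpace n => x.1 j := fun j => by fun_prop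
  have h2 : ∀ j, Continuous fun x : CSpace n × CSpace n => x.2 j := fun j => by fun_prop
  have h3 : regularPoints n = (⋂ j, {x | x.1 j ≠ 0}) ∩
      ⋃ j, {x : CSpace n × CSpace n | (starRingEnd ℂ (x.1 j) * x.2 j).re ≠ 0} := by
    ext x
    simp [regularPoints]
  rw [h3]
  refine (isOpen_iInter_of_finite fun j => isOpen_ne_fun (h1 j) continuous_const).inter
    (isOpen_iUnion fun j => isOpen_ne_fun ?_ continuous_const)
  exact Complex.continuous_re.comp ((Complex.continuous_conj.comp (h1 j)).mul (h2 j))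

include hb in
theorem tangentBundleOf_subset_closure_ne_zero :
    tangentBundleOf (unitQuadric (weightedMetric b)) ⊆
      closure (tangentBundleOf (unitQuadric (weightedMetric b)) ∩ {x | ∀ j, x.1 j ≠ 0}) := by
  have hs := weightedMetric_symm b
  have hp := weightedMetric_pos b hb
  rintro ⟨q, v⟩ hx
  obtain ⟨hq, hv⟩ := (mem_tangentBundleOf_unitQuadric hs hp).1 hx
  dsimp only at hq hv
  -- `u` is supported exactly on the vanishing coordinates of `q`, so every coordinate of `q + t •
  -- u` is nonzero for `t ≠ 0`.
  let u : CSpace n := WithLp.toLp 2 fun j => if q j = 0 then 1 else 0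
  let p : ℝ → CSpace n := fun t => radialProjection (weightedMetric b) (q + t • u)
  have hp0 : p 0 = q := by simpa [p] using radialProjection_of_mem hq
  have hpc : ContinuousAt p 0 := by
    refine ContinuousAt.comp (g := radialProjection (weightedMetric b)) ?_
      (contDiff_add_smul q u).continuous.continuousAt
    exact (contDiffAt_radialProjection (by simp [hq])).continuousAt
  have hne : ∀ t : ℝ, t ≠ 0 → ∀ j, (q + t • u) j ≠ 0 := by
    intro t ht j
    by_cases h : q j = 0 <;> simp [u, h, ht]
  have hpos : ∀ t : ℝ, t ≠ 0 → 0 < weightedMetric b (q + t • u) (q + t • u) := by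
    refine fun t ht => hp _ fun h0 => ?_
    have hne0 : q ≠ 0 := by
      rintro rfl
      simp at hq
    -- Some index is needed for nonvanishing coordinates to exclude the zero vector; it comes from
    -- `q ≠ 0`.
    obtain ⟨j, -⟩ : ∃ j, q j ≠ 0 := by
      by_contra h
      push Not at h
      exact hne0 (by ext j; simp [h j])
    exact hne t ht j (by simp [h0])
  have hcont : ContinuousAt (fun t => (p t, v - weightedMetric b (p t) v • p t)) 0 :=
    hpc.prodMk (continuousAt_const.sub
      ((((weightedMetric b).continuous.continuousAt.comp hpc).clm_apply continuousAt_const).smul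
        hpc))
  have hlim : Tendsto (fun t => (p t, v - weightedMetric b (p t) v • p t)) (𝓝[≠] 0)
      (𝓝 (q, v)) := by
    have h := hcont.tendsto.mono_left (nhdsWithin_le_nhds (s := {0}ᶜ))
    simpa only [hp0, hv, zero_smul, sub_zero] using h
  refine mem_closure_of_tendsto hlim ?_
  filter_upwards [self_mem_nhdsWithin] with t ht
  have hpm : weightedMetric b (p t) (p t) = 1 := radialProjection_mem (hpos t ht)
  refine ⟨(mem_tangentBundleOf_unitQuadric hs hp).2 ⟨hpm, by simp [hpm]⟩, fun j => ?_⟩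
  have h1 := (Real.sqrt_pos.2 (hpos t ht)).ne'
  have h2 : (p t) j = (√(weightedMetric b (q + t • u) (q + t • u)))⁻¹ • (q + t • u) j := rfl
  change (p t) j ≠ 0
  rw [h2]
  exact smul_ne_zero (inv_ne_zero h1) (hne t ht j)

theorem weightedMetric_single (b : Fin n → ℝ) (q : CSpace n) (j : Fin n) (c : ℂ) :
    weightedMetric b q (EuclideanSpace.single j c) = b j * (starRingEnd ℂ (q j) * c).re := by
  rw [weightedMetric_apply, weightedInner_eq, Finset.sum_eq_single j]
  · simp only [PiLp.single_apply, if_true, Complex.re_ofReal_mul]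
  · intro k _ hk
    simp [hk]
  · simp

include hb in
theorem tangentBundleOf_subset_closure_regularPoints (hn : 2 ≤ n) :
    tangentBundleOf (unitQuadric (weightedMetric b)) ⊆
      closure (tangentBundleOf (unitQuadric (weightedMetric b)) ∩ regularPoints n) := by
  have hs := weightedMetric_symm b
  have hp := weightedMetric_pos b hb
  refine (tangentBundleOf_subset_closure_ne_zero hb).trans
    (closure_minimal ?_ isClosed_closure)
  rintro ⟨q, v⟩ ⟨hx, hq0⟩
  obtain ⟨hq, hv⟩ := (mem_tangentBundleOf_unitQuadric hs hp).1 hx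
  dsimp only at hq hv hq0
  let i : Fin n := ⟨0, by omega⟩
  let k : Fin n := ⟨1, by omega⟩
  have hik : i ≠ k := by simp [i, k]
  by_cases hr : (starRingEnd ℂ (q i) * v i).re = 0
  swap
  · exact subset_closure ⟨hx, hq0, i, hr⟩
  -- The radial parts of `w` at `i` and `k` are scaled to contribute `1` and `-1` to `weightedMetric
  -- b q w`, so `w` is tangent but not angular. Two indices are essential: for `n = 1` every tangent
  -- vector is angular.
  let w : CSpace n := EuclideanSpace.single i ((b i : ℂ) * starRingEnd ℂ (q i))⁻¹ -
    EuclideanSpace.single k ((b k : ℂ) * starRingEnd ℂ (q k))⁻¹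
  have hbq : ∀ j, (starRingEnd ℂ (q j) * ((b j : ℂ) * starRingEnd ℂ (q j))⁻¹).re = (b j)⁻¹ := by
    intro j
    have h1 : starRingEnd ℂ (q j) ≠ 0 := (map_ne_zero _).2 (hq0 j)
    rw [mul_inv, mul_left_comm, mul_inv_cancel₀ h1, mul_one, ← Complex.ofReal_inv,
      Complex.ofReal_re]
  have hw : weightedMetric b q w = 0 := by
    simp only [w, map_sub, weightedMetric_single, hbq]
    rw [mul_inv_cancel₀ (hb i).ne', mul_inv_cancel₀ (hb k).ne', sub_self]
  have hwi : (starRingEnd ℂ (q i) * w i).re = (b i)⁻¹ := by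
    simpa [w, hik] using hbq i
  have hlim : Tendsto (fun t : ℝ => (q, v + t • w)) (𝓝[≠] 0) (𝓝 (q, v)) := by
    have h : Continuous fun t : ℝ => (q, v + t • w) := by fun_prop
    simpa using h.continuousAt.tendsto.mono_left (nhdsWithin_le_nhds (a := (0 : ℝ)) (s := {0}ᶜ))
  refine mem_closure_of_tendsto hlim ?_
  filter_upwards [self_mem_nhdsWithin] with t ht
  refine ⟨(mem_tangentBundleOf_unitQuadric hs hp).2 ⟨hq, by simp [hv, hw]⟩, hq0, i, ?_⟩
  have h1 : starRingEnd ℂ (q i) * (v + t • w) i =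
      starRingEnd ℂ (q i) * v i + t * (starRingEnd ℂ (q i) * w i) := by
    simp
    ring
  dsimp only
  rw [h1, Complex.add_re, hr, Complex.re_ofReal_mul, hwi, zero_add]
  exact mul_ne_zero ht (inv_ne_zero (hb i).ne')

include hb hG hV in
theorem independentAt_momentaAndEnergy {x : CSpace n × CSpace n}
    (hx : x ∈ tangentBundleOf (unitQuadric (weightedMetric b))) (hx' : x ∈ regularPoints n) :
    IndependentAt (weightedSystem (unitQuadric (weightedMetric b)) a ha).TM
      (momentaAndEnergy (weightedSystem (unitQuadric (weightedMetric b)) a ha) V) x := by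
  intro β hβ
  have hs := weightedMetric_symm b
  have hp := weightedMetric_pos b hb
  have hsum : ∀ W ∈ tangentVectors (tangentBundleOf (unitQuadric (weightedMetric b))) x,
      ∑ i, β i * fderiv ℝ (momentaAndEnergy (weightedSystem (unitQuadric (weightedMetric b)) a ha)
        G i) x W = 0 := by
    rintro _ ⟨c, hc, rfl⟩
    refine (HasDerivAt.deriv (HasDerivAt.fun_sum fun i _ =>
      HasDerivAt.const_mul (β i) ?_)).symm.trans (hβ c hc)
    exact MagneticSystem.hasDerivAt_comp_of_eqOn
      ((contDiff_momentaAndEnergy _ ha hG i).differentiable (by simp) x)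
      (eqOn_momentaAndEnergy _ ha hV i) hc
  obtain ⟨hq, hv⟩ := (mem_tangentBundleOf_unitQuadric hs hp).1 hx
  -- Along a vertical vector `(0, ζ)` the combined differential is the pairing of `ζ` with this `η`.
  -- As `η` is tangent, `ζ = η` is allowed and gives `weightedMetric a η η = 0`.
  set η : CSpace n := ∑ j : Fin n, β j.castSucc • angularMap j x.1 + β (Fin.last n) • x.2 with hη
  have hηt : ((0 : CSpace n), η) ∈
      tangentVectors (tangentBundleOf (unitQuadric (weightedMetric b))) x := by
    rw [mem_tangentVectors_tangentBundleOf_unitQuadric hs hp hx]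
    simp [hη, map_sum, weightedMetric_self_angularMap, hv]
  have h0 : weightedMetric a η η = 0 := by
    rw [← hsum _ hηt, Fin.sum_univ_castSucc]
    simp only [momentaAndEnergy_castSucc, momentaAndEnergy_last, fderiv_angularMomentum,
      fderiv_weightedSystem_energy _ a ha hG, map_zero, weightedMetric_symm a x.2 η]
    conv_lhs => rw [hη, map_add, ← hη, map_sum]
    simp
  have hη0 : η = 0 := by
    by_contra hne
    exact (weightedMetric_pos a ha η hne).ne' h0
  have hcoord : ∀ k, (β k.castSucc : ℂ) * (Complex.I * x.1 k) + β (Fin.last n) * x.2 k = 0 := by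
    intro k
    have h1 : η k = 0 := by simp [hη0]
    rw [← h1, hη]
    have h2 : ∀ j, (β j.castSucc • angularMap j x.1 : CSpace n) k =
        if j = k then (β k.castSucc : ℂ) * (Complex.I * x.1 k) else 0 := by
      intro j
      by_cases hjk : j = k
      · subst hjk
        simp [angularMap_apply, angularField]
      · simp [angularMap_apply, angularField, hjk, Ne.symm hjk]
    rw [PiLp.add_apply, WithLp.ofLp_sum, Finset.sum_apply, Finset.sum_congr rfl fun j _ => h2 j]
    simp
  obtain ⟨hq0, k, hk⟩ := hx'
  have hlast : β (Fin.last n) = 0 := by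
    -- Multiplying by the conjugate of `z_k` makes the angular term purely imaginary, so the real
    -- part isolates the coefficient of the energy.
    have h1 := congrArg (fun z => (starRingEnd ℂ (x.1 k) * z).re) (hcoord k)
    have h2 : starRingEnd ℂ (x.1 k) * ((β k.castSucc : ℂ) * (Complex.I * x.1 k) +
        β (Fin.last n) * x.2 k) =
        (β k.castSucc : ℂ) * (Complex.I * (Complex.normSq (x.1 k) : ℂ)) +
          (β (Fin.last n) : ℂ) * (starRingEnd ℂ (x.1 k) * x.2 k) := by
      rw [Complex.normSq_eq_conj_mul_self]
      ring
    dsimp only at h1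
    rw [h2, Complex.add_re, Complex.re_ofReal_mul, Complex.re_ofReal_mul, Complex.re_mul_ofReal,
      Complex.I_re] at h1
    have h3 : β (Fin.last n) * (starRingEnd ℂ (x.1 k) * x.2 k).re = 0 := by
      simpa only [zero_mul, mul_zero, zero_add, Complex.zero_re] using h1
    exact (mul_eq_zero.1 h3).resolve_right hk
  ext i
  induction i using Fin.lastCases with
  | last => exact hlast
  | cast j => simpa [hlast, hq0 j] using hcoord j

include hb hG hV hGA in
/-- The conjugate momenta and the energy of a weighted quadric are independent commuting
integrals. -/
theorem areIndependentCommutingIntegrals_momentaAndEnergy (hn : 2 ≤ n) :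
    (weightedSystem (unitQuadric (weightedMetric b)) a ha).AreIndependentCommutingIntegrals V
      (momentaAndEnergy (weightedSystem (unitQuadric (weightedMetric b)) a ha) V) := by
  refine ⟨fun i => ⟨_, contDiff_momentaAndEnergy _ ha hG i, eqOn_momentaAndEnergy _ ha hV i⟩,
    fun i => ?_, poissonCommute_momentaAndEnergy ha hb hG hV hGA, regularPoints n,
    isOpen_regularPoints, tangentBundleOf_subset_closure_regularPoints hb hn,
    fun x hx => independentAt_momentaAndEnergy ha hb hG hV hx.1 hx.2⟩
  induction i using Fin.lastCases with
  | last =>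
    rw [momentaAndEnergy_last]
    exact isIntegralOfMotion_energy ha hb hG hV
  | cast j =>
    rw [momentaAndEnergy_castSucc]
    exact isIntegralOfMotion_angularMomentum ha hb hG hV hGA j

/-! ### Dimension count, and the sphere and the ellipsoid as weighted quadrics. -/

theorem finrank_span_tangentVectors_unitQuadric {E : Type*} [NormedAddCommGroup E]
    [NormedSpace ℝ E] [FiniteDimensional ℝ E] {B : E →L[ℝ] E →L[ℝ] ℝ}
    (hs : ∀ v w, B v w = B w v) (hp : ∀ v, v ≠ 0 → 0 < B v v) {q : E} (hq : q ∈ unitQuadric B) :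
    Module.finrank ℝ (Submodule.span ℝ (tangentVectors (unitQuadric B) q)) + 1 =
      Module.finrank ℝ E := by
  have h1 : tangentVectors (unitQuadric B) q = ((B q).toLinearMap.ker : Set E) := by
    ext v
    simpa using mem_tangentVectors_unitQuadric hs hp hq
  have h2 : (B q).toLinearMap ≠ 0 := fun h => by
    have h3 : B q q = 0 := LinearMap.congr_fun h q
    have h4 : B q q = 1 := hq
    linarith
  rw [h1, Submodule.span_eq]
  exact Module.Dual.finrank_ker_add_one_of_ne_zero h2

-- The dimension is `2n - 1`, which equals the number `n + 1` of integrals exactly when `n = 2`.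
include hb hG hV hGA in
theorem isCompletelyIntegrable_of_eq_two (hn : n = 2) :
    (weightedSystem (unitQuadric (weightedMetric b)) a ha).IsCompletelyIntegrable V := by
  refine ⟨n + 1, _, fun q hq => ?_,
    areIndependentCommutingIntegrals_momentaAndEnergy ha hb hG hV hGA hn.ge⟩
  have h1 := finrank_span_tangentVectors_unitQuadric (weightedMetric_symm b)
    (weightedMetric_pos b hb) hq
  have h2 : Module.finrank ℝ (CSpace n) = 2 * n := by
    rw [finrank_real_of_complex, finrank_euclideanSpace_fin]
  change Module.finrank ℝ (Submodule.span ℝ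
    (tangentVectors (unitQuadric (weightedMetric b)) q)) = n + 1
  omega

theorem sphere_eq_unitQuadric :
    Metric.sphere (0 : CSpace n) 1 = unitQuadric (weightedMetric fun _ => 1) := by
  ext z
  have h1 : weightedMetric (fun _ => 1) z z = ‖z‖ ^ 2 := by
    rw [weightedMetric_apply, weightedInner_eq, EuclideanSpace.norm_sq_eq, Complex.re_sum]
    refine Finset.sum_congr rfl fun j _ => ?_
    rw [← Complex.normSq_eq_conj_mul_self, Complex.normSq_eq_norm_sq,
      Complex.ofReal_one, one_mul, Complex.ofReal_re]
  rw [mem_sphere_zero_iff_norm]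
  change _ ↔ weightedMetric (fun _ => 1) z z = 1
  rw [h1]
  exact (pow_eq_one_iff_of_nonneg (norm_nonneg z) two_ne_zero).symm

theorem ellipsoid_eq_unitQuadric (a : Fin n → ℝ) :
    ellipsoid a = unitQuadric (weightedMetric fun j => (a j)⁻¹) := by
  ext z
  -- The ellipsoid is cut out by a complex equation; its imaginary part is vacuous because the
  -- potential is antisymmetric.
  have h1 : (weightedInner (fun j => (a j)⁻¹) z z).im = 0 := by
    have h := weightedPotential_antisymm (fun j => (a j)⁻¹) z z
    rw [weightedPotential_apply] at h
    linarith
  change weightedInner (fun j => (a j)⁻¹) z z = 1 ↔ (weightedInner (fun j => (a j)⁻¹) z z).re = 1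
  simp [Complex.ext_iff, h1]

/-- A function on the sphere which is independent of the angles has vanishing angular
derivatives. -/
theorem IndependentOfAngles.fderiv_angularMap {V G : CSpace n → ℝ} (hV : IndependentOfAngles V)
    (hG : ContDiff ℝ ∞ G) (hVG : EqOn V G (Metric.sphere 0 1)) {q : CSpace n}
    (hq : q ∈ Metric.sphere (0 : CSpace n) 1) (j : Fin n) :
    fderiv ℝ G q (angularMap j q) = 0 := by
  -- At a zero coordinate the angle takes the default `arg 0 = 0`, which is harmless because the
  -- radius is `0` there. The curve `c` multiplies the coordinate `j` by `e^{is}`, written through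
  -- sine and cosine so that its velocity at `0` can be read off.
  let θ : Fin n → ℝ := fun k => ‖q k‖
  let φ : ℝ → Fin n → ℝ := fun s k => (q k).arg + if k = j then s else 0
  let c : ℝ → CSpace n := fun s =>
    q + (Real.sin s • angularMap j q + (Real.cos s - 1) • EuclideanSpace.single j (q j))
  have hθ : ∑ k, θ k ^ 2 = 1 := by
    rw [← EuclideanSpace.norm_sq_eq, mem_sphere_zero_iff_norm.1 hq, one_pow]
  have hpolar : ∀ z : ℂ, (‖z‖ : ℂ) * Complex.exp (Complex.I * z.arg) = z := fun z => by
    rw [mul_comm Complex.I]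
    exact Complex.norm_mul_exp_arg_mul_I z
  have hc : ∀ s, c s = polarPoint θ (φ s) := by
    intro s
    ext k
    by_cases hk : k = j
    · subst hk
      have h1 : polarPoint θ (φ s) k = q k * Complex.exp (s * Complex.I) := by
        have h2 : Complex.I * ((q k).arg + s) = Complex.I * (q k).arg + s * Complex.I := by ring
        simp only [polarPoint, θ, φ, if_true, Complex.ofReal_add]
        rw [h2, Complex.exp_add, ← mul_assoc, hpolar]
      rw [h1, Complex.exp_mul_I]
      simp [c, angularMap_apply, angularField]
      ring
    · have h1 : polarPoint θ (φ s) k = q k := by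
        simp only [polarPoint, θ, φ, if_neg hk, add_zero]
        exact hpolar (q k)
      rw [h1]
      simp [c, angularMap_apply, angularField, hk]
  have hcS : ∀ s, c s ∈ Metric.sphere (0 : CSpace n) 1 := by
    intro s
    rw [mem_sphere_zero_iff_norm, ← pow_eq_one_iff_of_nonneg (norm_nonneg _) two_ne_zero, hc,
      EuclideanSpace.norm_sq_eq, ← hθ]
    refine Finset.sum_congr rfl fun k _ => ?_
    have h1 : Complex.I * (φ s k : ℂ) = (φ s k : ℂ) * Complex.I := mul_comm _ _
    simp [polarPoint, h1, Complex.norm_exp_ofReal_mul_I, θ]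
  have hcd : HasDerivAt c (angularMap j q) 0 := by
    have h1 := ((((Real.hasDerivAt_sin 0).smul_const (angularMap j q)).fun_add
      (((Real.hasDerivAt_cos 0).sub_const 1).smul_const
        (EuclideanSpace.single j (q j)))).const_add q)
    refine h1.congr_deriv ?_
    simp
  have hc0 : c 0 = q := by simp [c]
  have h1 : HasDerivAt (fun s => G (c s)) (fderiv ℝ G (c 0) (angularMap j q)) 0 :=
    ((hG.differentiable (by simp)) (c 0)).hasFDerivAt.comp_hasDerivAt (0 : ℝ) hcd
  have h2 : (fun s => G (c s)) = fun _ => V (polarPoint θ (φ 0)) := by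
    ext s
    rw [← hVG (hcS s), hc]
    exact hV θ (φ s) (φ 0) hθ
  rw [h2, hc0] at h1
  exact h1.unique (hasDerivAt_const _ _)

end WeightedQuadric

theorem mainTheorem9 (n : ℕ) (hn : 2 ≤ n) (a : Fin n → ℝ) (ha : ∀ j, 0 < a j)
    (hmono : Monotone a) :
    (∀ V : CSpace n → ℝ, IsSmoothOnSubmanifold (Metric.sphere (0 : CSpace n) 1) V →
      IndependentOfAngles V →
        (sphereSystem a ha).AreIndependentCommutingIntegrals V
          (momentaAndEnergy (sphereSystem a ha) V) ∧
        (n = 2 → (sphereSystem a ha).IsCompletelyIntegrable V)) ∧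
    (ellipsoidSystem a).AreIndependentCommutingIntegrals 0
      (momentaAndEnergy (ellipsoidSystem a) 0) ∧
    (n = 2 → (ellipsoidSystem a).IsCompletelyIntegrable 0) := by
  constructor
  · rintro V ⟨G, hG, hVG⟩ hV
    have hGA := fun q (hq : q ∈ Metric.sphere (0 : CSpace n) 1) j =>
      hV.fderiv_angularMap hG hVG hq j
    unfold sphereSystem
    -- Sphere: weights `1` for the quadric and `a` for the metric and potential.
    rw [sphere_eq_unitQuadric] at hVG hGA ⊢
    exact ⟨areIndependentCommutingIntegrals_momentaAndEnergy ha (fun _ => one_pos) hG hVG hGA hn,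
      isCompletelyIntegrable_of_eq_two ha (fun _ => one_pos) hG hVG hGA⟩
  · have hb : ∀ j, 0 < (a j)⁻¹ := fun j => inv_pos.2 (ha j)
    unfold ellipsoidSystem
    -- Ellipsoid: weights `1/a` for the quadric and `1` for the metric and potential.
    rw [ellipsoid_eq_unitQuadric]
    have hG : ContDiff ℝ ∞ (0 : CSpace n → ℝ) := contDiff_const
    exact ⟨areIndependentCommutingIntegrals_momentaAndEnergy _ hb hG (fun _ _ => rfl)
        (by simp) hn,
      isCompletelyIntegrable_of_eq_two _ hb hG (fun _ _ => rfl) (by simp)⟩
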